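/- Let $\rho$ be a left-invariant metric on $PSL(2,\mathbf R)$ inducing its usual topology. Let $H$ be a subgroup of $PSL(2,\mathbf R)$ generated by a finite set $S$. Suppose that $H$ is not discrete and not elementary; here $H$ is called elementary if it fixes a point of the hyperbolic plane $\mathbf H^2$, fixes a point of the circle at infinity $\partial\mathbf H^2$, or preserves an axis (a complete geodesic of $\mathbf H^2$). For $\epsilon>0$ and $n\in\mathbf N$ let $$H^n_{\epsilon}=\{h\in H : h \text{ has word length at most } n \text{ with respect to } S,\ \rho(h,e)\le\epsilon\}.$$ Then for every $\epsilon_0>0$ the function $n\mapsto|H^n_{\epsilon_0}|$ (the semilocal growth of $H$ in $PSL(2,\mathbf R)$) grows faster than $2^{\sqrt n/4}$, that is, $$\lim_{n\to\infty}\frac{2^{\sqrt n/4}}{|H^n_{\epsilon_0}|}=0 .$$ In particular it is superpolynomial: for every $k\in\mathbf N$, $n^k/|H^n_{\epsilon_0}|\to0$ as $n\to\infty$. -/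

import Mathlib

open Filter Asymptotics

open scoped LinearAlgebra.Projectivization UpperHalfPlane

/-- The Lie group `PSL(2, ℝ) = SL(2, ℝ) / {±1}`; it carries the quotient topology. -/
abbrev PSL2R : Type := Matrix.ProjectiveSpecialLinearGroup (Fin 2) ℝ

/-- `ρ` is a metric on the topological group `L` which is invariant under left translations and
induces the given topology of `L`. -/
structure IsLeftInvariantMetric {L : Type*} [Group L] [TopologicalSpace L]
    (ρ : L → L → ℝ) : Prop where
  dist_self : ∀ x, ρ x x = 0
  eq_of_dist_eq_zero : ∀ x y, ρ x y = 0 → x = y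
  symm : ∀ x y, ρ x y = ρ y x
  triangle : ∀ x y z, ρ x z ≤ ρ x y + ρ y z
  left_invariant : ∀ g x y, ρ (g * x) (g * y) = ρ x y
  isOpen_iff : ∀ U : Set L, IsOpen U ↔ ∀ x ∈ U, ∃ r > 0, ∀ y, ρ x y < r → y ∈ U

/-- The elements of word length at most `n` with respect to `S`: the products of at most `n`
factors, each of which is an element of `S` or the inverse of one. -/
def wordBall {L : Type*} [Group L] (S : Set L) (n : ℕ) : Set L :=
  {g | ∃ l : List L, l.length ≤ n ∧ (∀ x ∈ l, x ∈ S ∨ x⁻¹ ∈ S) ∧ l.prod = g}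

/-- The set `G^n_ε` of all elements of the group `G` generated by `S` which have word length at
most `n` with respect to `S` and whose `ρ`-distance to the identity is at most `ε`. -/
def semilocalBall {L : Type*} [Group L] (ρ : L → L → ℝ) (S : Set L) (ε : ℝ) (n : ℕ) : Set L :=
  {g | g ∈ wordBall S n ∧ ρ g 1 ≤ ε}

/-- The semilocal growth function `n ↦ |G^n_ε|`. The set counted is finite when `S` is, by
`finite_semilocalBall` below. -/
noncomputable def semilocalGrowth {L : Type*} [Group L] (ρ : L → L → ℝ) (S : Set L) (ε : ℝ)
    (n : ℕ) : ℕ :=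
  (semilocalBall ρ S ε n).ncard

theorem finite_semilocalBall {L : Type*} [Group L] (ρ : L → L → ℝ) {S : Set L} (hS : S.Finite)
    (ε : ℝ) (n : ℕ) : (semilocalBall ρ S ε n).Finite := by
  have hT : (S ∪ S⁻¹).Finite := hS.union hS.inv
  have : Finite ↥(S ∪ S⁻¹) := hT
  refine ((List.finite_length_le ↥(S ∪ S⁻¹) n).image
    (fun l => (l.map Subtype.val).prod)).subset ?_
  rintro g ⟨⟨l, hl, hx, rfl⟩, -⟩
  exact ⟨l.attach.map (fun x => ⟨x.1, hx x.1 x.2⟩), by simpa using hl, by simp⟩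

/-- A subgroup of `PSL(2, ℝ)` is elementary if it fixes a point of the hyperbolic plane `ℍ`, or
fixes a point of the circle at infinity, or preserves an axis.

The action on `ℍ` is by Möbius transformations, through representatives in `SL(2, ℝ)`. The circle
at infinity is the real projective line, with the action of `PSL(2, ℝ)` induced by linear maps; an
axis (a complete geodesic of `ℍ`) is given by the unordered pair of its two endpoints. -/
def IsElementary (H : Subgroup PSL2R) : Prop :=
  (∃ z : ℍ, ∀ g : Matrix.SpecialLinearGroup (Fin 2) ℝ, (g : PSL2R) ∈ H → g • z = z) ∨
  (∃ p : ℙ ℝ (Fin 2 → ℝ), ∀ g ∈ H, g • p = p) ∨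
  (∃ p q : ℙ ℝ (Fin 2 → ℝ), p ≠ q ∧
    ∀ g ∈ H, ({g • p, g • q} : Set (ℙ ℝ (Fin 2 → ℝ))) = {p, q})

/-! Two elements near the identity generate, by iterated commutators, elements that approach the
identity very fast at a low cost in word length. With p_{n+2} = [p_{n+1}, p_n⁻¹], cancellation makes
the length only double in each step (`commutatorSeq_mem_wordBall`), while the exponent of smallness
follows the Fibonacci recursion (`nearOne_commutatorSeq`). At length about 2^i one thus has p within
2^(-F) of 1, where F = fib (i + 1) grows at least like (3/2)^i.

So small an element stays small after conjugation by any word of length m, for m a small multiple of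
F. Ping-pong (`exists_pingPong`) provides 2^m such words, and if p is hyperbolic their conjugates
are told apart by the fixed point of eigenvalue μ > 1 (`exists_injective_conj`). Hyperbolicity comes
from Fricke's identity: the traces obey a recursion in which one of any two consecutive terms
exceeds 2 (`slTrace_commutatorSeq_pos`). Together this is `exists_many_near_one`; since 3/2 > √2, a
count of 2^(κ(3/2)^i) at length D·2^i beats 2^(√n/4).

The starting pair, a hyperbolic b and an a moving both fixed points of b, is found in
`exists_conj_diagonal_pair`: if a non-hyperbolic element near 1 had no hyperbolic commutator with a
generator, its fixed point would be fixed by the whole group, making it elementary. -/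

open Matrix (SpecialLinearGroup)

open scoped Topology

/-! ### Word length -/

section WordBall

variable {L M : Type*} [Group L] [Group M]

theorem one_mem_wordBall (S : Set L) (n : ℕ) : (1 : L) ∈ wordBall S n :=
  ⟨[], by simp, by simp, rfl⟩

theorem wordBall_mono (S : Set L) {m n : ℕ} (h : m ≤ n) : wordBall S m ⊆ wordBall S n := by
  rintro g ⟨l, hl, hS, rfl⟩
  exact ⟨l, hl.trans h, hS, rfl⟩

theorem mul_mem_wordBall {S : Set L} {m n : ℕ} {x y : L} (hx : x ∈ wordBall S m)
    (hy : y ∈ wordBall S n) : x * y ∈ wordBall S (m + n) := by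
  obtain ⟨l, hl, hS, rfl⟩ := hx
  obtain ⟨l', hl', hS', rfl⟩ := hy
  refine ⟨l ++ l', by simp; omega, ?_, by simp⟩
  intro x hx
  rcases List.mem_append.1 hx with h | h
  exacts [hS x h, hS' x h]

theorem inv_mem_wordBall {S : Set L} {n : ℕ} {x : L} (hx : x ∈ wordBall S n) :
    x⁻¹ ∈ wordBall S n := by
  obtain ⟨l, hl, hS, rfl⟩ := hx
  refine ⟨(l.map (·⁻¹)).reverse, by simpa using hl, ?_, by rw [List.prod_inv_reverse]⟩
  intro x hx
  simp only [List.mem_reverse, List.mem_map] at hx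
  obtain ⟨y, hy, rfl⟩ := hx
  simpa using (hS y hy).symm

theorem mem_wordBall_one {S : Set L} {x : L} (hx : x ∈ S) : x ∈ wordBall S 1 :=
  ⟨[x], by simp, by simp [hx], by simp⟩

theorem list_prod_mem_wordBall {S : Set L} {k : ℕ} (l : List L)
    (h : ∀ x ∈ l, x ∈ wordBall S k) : l.prod ∈ wordBall S (l.length * k) := by
  induction l with
  | nil => exact one_mem_wordBall _ _
  | cons x l ih =>
    rw [List.prod_cons]
    refine wordBall_mono S (le_of_eq ?_)
      (mul_mem_wordBall (h x (by simp)) (ih fun y hy => h y (by simp [hy])))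
    simp only [List.length_cons]
    ring

theorem pow_mem_wordBall {S : Set L} {k : ℕ} {x : L} (hx : x ∈ wordBall S k) (n : ℕ) :
    x ^ n ∈ wordBall S (n * k) := by
  simpa using list_prod_mem_wordBall (S := S) (k := k) (List.replicate n x)
    (fun y hy => by rw [List.eq_of_mem_replicate hy]; exact hx)

theorem map_mem_wordBall {T : Set L} {S : Set M} {k n : ℕ} (f : L →* M)
    (hf : ∀ x ∈ T, f x ∈ wordBall S k) {x : L} (hx : x ∈ wordBall T n) :
    f x ∈ wordBall S (n * k) := by
  obtain ⟨l, hl, hT, rfl⟩ := hx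
  rw [map_list_prod]
  refine wordBall_mono S ?_ (list_prod_mem_wordBall (S := S) (k := k) (l.map f) ?_)
  · rw [List.length_map]; exact Nat.mul_le_mul_right _ hl
  · intro y hy
    obtain ⟨x, hx, rfl⟩ := List.mem_map.1 hy
    rcases hT x hx with h | h
    · exact hf x h
    · have := inv_mem_wordBall (hf _ h)
      rwa [map_inv, inv_inv] at this

theorem exists_mem_wordBall_of_mem_closure {S : Set L} {x : L} (hx : x ∈ Subgroup.closure S) :
    ∃ n, x ∈ wordBall S n := by
  induction hx using Subgroup.closure_induction with
  | mem x hx => exact ⟨1, mem_wordBall_one hx⟩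
  | one => exact ⟨0, one_mem_wordBall _ _⟩
  | mul x y _ _ hx hy =>
    obtain ⟨m, hm⟩ := hx
    obtain ⟨n, hn⟩ := hy
    exact ⟨_, mul_mem_wordBall hm hn⟩
  | inv x _ hx =>
    obtain ⟨m, hm⟩ := hx
    exact ⟨m, inv_mem_wordBall hm⟩

end WordBall

/-! ### Iterated commutators with doubling word length -/

section CommutatorSequence

variable {L : Type*} [Group L]

/-- The pairs `(p, q)` obtained from `(b, a⁻¹b⁻¹a)` by iterating `(p, q) ↦ (pq, p⁻¹q⁻¹)`. The
first components are iterated commutators, while the word length only doubles in each step. -/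
def commutatorPair (a b : L) : ℕ → L × L
  | 0 => (b, a⁻¹ * b⁻¹ * a)
  | n + 1 => ((commutatorPair a b n).1 * (commutatorPair a b n).2,
      (commutatorPair a b n).1⁻¹ * (commutatorPair a b n).2⁻¹)

/-- The sequence with `p₀ = b`, `p₁ = [b, a⁻¹]` and `pₙ₊₂ = [pₙ₊₁, pₙ⁻¹]`. -/
def commutatorSeq (a b : L) (n : ℕ) : L := (commutatorPair a b n).1

theorem commutatorSeq_zero (a b : L) : commutatorSeq a b 0 = b := rfl

theorem commutatorSeq_one (a b : L) : commutatorSeq a b 1 = b * a⁻¹ * b⁻¹ * a := by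
  simp only [commutatorSeq, commutatorPair]
  group

/-- Here q_n = p_n⁻¹ p_{n+1}, so [p_{n+1}, p_n⁻¹] collapses to [p_n, q_n] = p_{n+1} q_{n+1}. Without
this cancellation the length would grow by a factor larger than 2, and the final exponent would
suffer. -/
theorem commutatorSeq_add_two (a b : L) (n : ℕ) :
    commutatorSeq a b (n + 2) = commutatorSeq a b (n + 1) * (commutatorSeq a b n)⁻¹ *
      (commutatorSeq a b (n + 1))⁻¹ * commutatorSeq a b n := by
  simp only [commutatorSeq, commutatorPair]
  group

theorem commutatorSeq_mem_wordBall (a b : L) (n : ℕ) :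
    commutatorSeq a b n ∈ wordBall {a, b} (3 * 2 ^ n) := by
  have ha : a ∈ wordBall {a, b} 1 := mem_wordBall_one (by simp)
  have hb : b ∈ wordBall {a, b} 1 := mem_wordBall_one (by simp)
  suffices (commutatorPair a b n).1 ∈ wordBall {a, b} (3 * 2 ^ n) ∧
      (commutatorPair a b n).2 ∈ wordBall {a, b} (3 * 2 ^ n) from this.1
  induction n with
  | zero =>
    exact ⟨wordBall_mono _ (by norm_num) hb, wordBall_mono _ (by norm_num) (mul_mem_wordBall
      (mul_mem_wordBall (inv_mem_wordBall ha) (inv_mem_wordBall hb)) ha)⟩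
  | succ n ih =>
    have h : 3 * 2 ^ (n + 1) = 3 * 2 ^ n + 3 * 2 ^ n := by ring
    rw [h]
    exact ⟨mul_mem_wordBall ih.1 ih.2,
      mul_mem_wordBall (inv_mem_wordBall ih.1) (inv_mem_wordBall ih.2)⟩

end CommutatorSequence

/-! ### Commutators contract quadratically near the identity -/

section Contraction

/-- The difference equals [u - 1, v' - 1] u'v, where the additive commutator has norm at most 2rs
and each of u', v has norm at most 2. -/
theorem norm_mul_inv_mul_inv_mul_sub_one_le {R : Type*} [NormedRing R] [NormOneClass R]
    {u u' v v' : R} {r s : ℝ} (hu : u * u' = 1) (hv : v' * v = 1) (hr : r ≤ 1) (hs : s ≤ 1)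
    (h1 : ‖u - 1‖ ≤ r) (h2 : ‖u' - 1‖ ≤ r) (h3 : ‖v - 1‖ ≤ s) (h4 : ‖v' - 1‖ ≤ s) :
    ‖u * v' * u' * v - 1‖ ≤ 8 * (r * s) := by
  have hr0 : 0 ≤ r := (norm_nonneg _).trans h1
  have hs0 : 0 ≤ s := (norm_nonneg _).trans h3
  have key : u * v' * u' * v - 1 =
      ((u - 1) * (v' - 1) - (v' - 1) * (u - 1)) * (u' * v) := by
    have : ((u - 1) * (v' - 1) - (v' - 1) * (u - 1)) * (u' * v) =
        u * v' * u' * v - v' * (u * u') * v := by noncomm_ring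
    rw [this, hu, mul_one, hv]
  have b1 : ‖u'‖ ≤ 2 := by
    calc ‖u'‖ = ‖(u' - 1) + 1‖ := by simp
      _ ≤ ‖u' - 1‖ + ‖(1 : R)‖ := norm_add_le _ _
      _ ≤ 2 := by rw [norm_one]; linarith
  have b2 : ‖v‖ ≤ 2 := by
    calc ‖v‖ = ‖(v - 1) + 1‖ := by simp
      _ ≤ ‖v - 1‖ + ‖(1 : R)‖ := norm_add_le _ _
      _ ≤ 2 := by rw [norm_one]; linarith
  have b3 : ‖u' * v‖ ≤ 4 := (norm_mul_le _ _).trans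
    ((mul_le_mul b1 b2 (norm_nonneg _) (by norm_num)).trans (by norm_num))
  have b4 : ‖(u - 1) * (v' - 1)‖ ≤ r * s :=
    (norm_mul_le _ _).trans (mul_le_mul h1 h4 (norm_nonneg _) hr0)
  have b5 : ‖(v' - 1) * (u - 1)‖ ≤ r * s := by
    rw [mul_comm r s]
    exact (norm_mul_le _ _).trans (mul_le_mul h4 h1 (norm_nonneg _) hs0)
  rw [key]
  calc _ ≤ ‖(u - 1) * (v' - 1) - (v' - 1) * (u - 1)‖ * ‖u' * v‖ := norm_mul_le _ _
    _ ≤ (r * s + r * s) * 4 :=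
        mul_le_mul ((norm_sub_le _ _).trans (add_le_add b4 b5)) b3 (norm_nonneg _) (by positivity)
    _ = 8 * (r * s) := by ring

attribute [local instance] Matrix.linftyOpNormedRing Matrix.linfty_opNormOneClass

/-- `X` and its inverse are within `r` of the identity, in the operator norm for the sup norm. -/
def NearOne (r : ℝ) (X : SpecialLinearGroup (Fin 2) ℝ) : Prop :=
  ‖(X : Matrix (Fin 2) (Fin 2) ℝ) - 1‖ ≤ r ∧ ‖((X⁻¹ : SpecialLinearGroup (Fin 2) ℝ) :
    Matrix (Fin 2) (Fin 2) ℝ) - 1‖ ≤ r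

theorem NearOne.mono {r s : ℝ} {X : SpecialLinearGroup (Fin 2) ℝ} (h : NearOne r X) (hrs : r ≤ s) :
    NearOne s X :=
  ⟨h.1.trans hrs, h.2.trans hrs⟩

theorem NearOne.commutator {r s : ℝ} {X Y : SpecialLinearGroup (Fin 2) ℝ} (hX : NearOne r X)
    (hY : NearOne s Y) (hr : r ≤ 1) (hs : s ≤ 1) :
    NearOne (8 * (r * s)) (X * Y⁻¹ * X⁻¹ * Y) := by
  have e : ∀ Z : SpecialLinearGroup (Fin 2) ℝ,
      (Z : Matrix (Fin 2) (Fin 2) ℝ) * ((Z⁻¹ : SpecialLinearGroup (Fin 2) ℝ) :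
        Matrix (Fin 2) (Fin 2) ℝ) = 1 := fun Z => by
    rw [← Matrix.SpecialLinearGroup.coe_mul, mul_inv_cancel, Matrix.SpecialLinearGroup.coe_one]
  have e' : ∀ Z : SpecialLinearGroup (Fin 2) ℝ,
      ((Z⁻¹ : SpecialLinearGroup (Fin 2) ℝ) : Matrix (Fin 2) (Fin 2) ℝ) *
        (Z : Matrix (Fin 2) (Fin 2) ℝ) = 1 := fun Z => by
    rw [← Matrix.SpecialLinearGroup.coe_mul, inv_mul_cancel, Matrix.SpecialLinearGroup.coe_one]
  constructor
  · simp only [Matrix.SpecialLinearGroup.coe_mul]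
    exact norm_mul_inv_mul_inv_mul_sub_one_le (e X) (e' Y) hr hs hX.1 hX.2 hY.1 hY.2
  · have : (X * Y⁻¹ * X⁻¹ * Y)⁻¹ = Y⁻¹ * X * Y * X⁻¹ := by group
    rw [this, mul_comm r s]
    simp only [Matrix.SpecialLinearGroup.coe_mul]
    exact norm_mul_inv_mul_inv_mul_sub_one_le (e' Y) (e X) hs hr hY.2 hY.1 hX.2 hX.1

/-- The factor 1/8 absorbs the constant 8 of the commutator estimate: 8 · (x/8) · (y/8) = xy/8, so
the exponents simply add, as Fibonacci numbers do. -/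
theorem nearOne_commutatorSeq {a b : SpecialLinearGroup (Fin 2) ℝ} (ha : NearOne (1 / 32) a)
    (hb : NearOne (1 / 32) b) (n : ℕ) :
    NearOne (1 / 8 * (1 / 2) ^ Nat.fib (n + 1)) (commutatorSeq a b n) := by
  have hle : ∀ k : ℕ, (1 / 8 * (1 / 2) ^ k : ℝ) ≤ 1 := fun k => by
    have : (1 / 2 : ℝ) ^ k ≤ 1 := pow_le_one₀ (by norm_num) (by norm_num)
    linarith
  induction n using Nat.twoStepInduction with
  | zero => exact hb.mono (by norm_num)
  | one =>
    rw [commutatorSeq_one]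
    exact (hb.commutator ha (by norm_num) (by norm_num)).mono (by norm_num)
  | more n h0 h1 =>
    rw [commutatorSeq_add_two]
    refine (h1.commutator h0 (hle _) (hle _)).mono (le_of_eq ?_)
    rw [show n + 2 + 1 = (n + 1) + 2 by ring, Nat.fib_add_two (n := n + 1), pow_add]
    ring

theorem norm_entry_le (M : Matrix (Fin 2) (Fin 2) ℝ) (i j : Fin 2) : |M i j| ≤ ‖M‖ := by
  rw [Matrix.linfty_opNorm_def]
  have h1 : ‖M i j‖₊ ≤ ∑ j, ‖M i j‖₊ :=
    Finset.single_le_sum (f := fun j => ‖M i j‖₊) (fun _ _ => zero_le) (Finset.mem_univ j)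
  have h2 := Finset.le_sup (f := fun i => ∑ j, ‖M i j‖₊) (Finset.mem_univ i)
  have h3 := h1.trans h2
  exact_mod_cast h3

theorem norm_le_of_entry_le {M : Matrix (Fin 2) (Fin 2) ℝ} {r : ℝ} (hr : 0 ≤ r)
    (h : ∀ i j, |M i j| ≤ r) : ‖M‖ ≤ 2 * r := by
  rw [Matrix.linfty_opNorm_def]
  lift r to NNReal using hr
  have : (Finset.univ.sup fun i => ∑ j, ‖M i j‖₊) ≤ 2 * r := by
    refine Finset.sup_le fun i _ => ?_
    rw [Fin.sum_univ_two, two_mul]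
    exact add_le_add (by exact_mod_cast h i 0) (by exact_mod_cast h i 1)
  exact_mod_cast this

theorem nearOne_of_entry_le {X : SpecialLinearGroup (Fin 2) ℝ} {r : ℝ}
    (h : ∀ i j, |X i j - (1 : Matrix (Fin 2) (Fin 2) ℝ) i j| ≤ r) : NearOne (2 * r) X := by
  have hr : 0 ≤ r := (abs_nonneg _).trans (h 0 0)
  refine ⟨norm_le_of_entry_le hr fun i j => h i j, norm_le_of_entry_le hr ?_⟩
  have h00 := h 0 0
  have h01 := h 0 1
  have h10 := h 1 0
  have h11 := h 1 1
  rw [Matrix.SpecialLinearGroup.coe_inv, Matrix.adjugate_fin_two]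
  intro i j
  fin_cases i <;> fin_cases j <;> simp_all

end Contraction

/-! ### Trace identities and the trace recursion -/

section Trace

theorem det_fin_two_eq_one (X : SpecialLinearGroup (Fin 2) ℝ) :
    X 0 0 * X 1 1 - X 0 1 * X 1 0 = 1 := by
  rw [← Matrix.det_fin_two]; exact X.2

theorem mul_entry (X Y : SpecialLinearGroup (Fin 2) ℝ) (i j : Fin 2) :
    (X * Y) i j = X i 0 * Y 0 j + X i 1 * Y 1 j := by
  rw [Matrix.SpecialLinearGroup.coe_mul, Matrix.mul_apply, Fin.sum_univ_two]

theorem inv_entry (X : SpecialLinearGroup (Fin 2) ℝ) :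
    X⁻¹ 0 0 = X 1 1 ∧ X⁻¹ 0 1 = -X 0 1 ∧ X⁻¹ 1 0 = -X 1 0 ∧ X⁻¹ 1 1 = X 0 0 := by
  rw [Matrix.SpecialLinearGroup.coe_inv, Matrix.adjugate_fin_two]
  simp

/-- The trace of an element of `SL(2, ℝ)`. -/
def slTrace (X : SpecialLinearGroup (Fin 2) ℝ) : ℝ := X 0 0 + X 1 1

theorem slTrace_mul_comm (X Y : SpecialLinearGroup (Fin 2) ℝ) :
    slTrace (X * Y) = slTrace (Y * X) := by
  simp only [slTrace, mul_entry]; ring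

theorem slTrace_inv (X : SpecialLinearGroup (Fin 2) ℝ) : slTrace X⁻¹ = slTrace X := by
  obtain ⟨h1, -, -, h4⟩ := inv_entry X
  rw [slTrace, slTrace, h1, h4, add_comm]

/-- Fricke's identity. -/
theorem slTrace_commutator (c X : SpecialLinearGroup (Fin 2) ℝ) :
    slTrace (c * X⁻¹ * c⁻¹ * X) = slTrace c ^ 2 + slTrace X ^ 2 + slTrace (X⁻¹ * c) ^ 2 -
      slTrace c * slTrace X * slTrace (X⁻¹ * c) - 2 := by
  have hc := det_fin_two_eq_one c
  have hX := det_fin_two_eq_one X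
  obtain ⟨c1, c2, c3, c4⟩ := inv_entry c
  obtain ⟨x1, x2, x3, x4⟩ := inv_entry X
  simp only [slTrace, mul_entry, c1, c2, c3, c4, x1, x2, x3, x4]
  linear_combination (c 0 0 + c 1 1) ^ 2 * hX + (X 0 0 + X 1 1) ^ 2 * hc -
    2 * ((X 0 0 * X 1 1 - X 0 1 * X 1 0) * hc + hX)

/-- For X and its commutator with Y⁻¹, the product is Y⁻¹X⁻¹Y, a conjugate of X⁻¹. This removes the
mixed trace from Fricke's identity, so that the recursion closes up in the traces alone. -/
theorem slTrace_inv_mul_commutatorSeq (a b : SpecialLinearGroup (Fin 2) ℝ) (n : ℕ) :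
    slTrace ((commutatorSeq a b n)⁻¹ * commutatorSeq a b (n + 1)) =
      slTrace (commutatorSeq a b n) := by
  have key : ∀ X Y : SpecialLinearGroup (Fin 2) ℝ,
      slTrace (X⁻¹ * (X * Y⁻¹ * X⁻¹ * Y)) = slTrace X := fun X Y => by
    rw [show X⁻¹ * (X * Y⁻¹ * X⁻¹ * Y) = Y⁻¹ * (X⁻¹ * Y) by group, slTrace_mul_comm,
      mul_inv_cancel_right, slTrace_inv]
  cases n with
  | zero => rw [commutatorSeq_one, commutatorSeq_zero]; exact key b a
  | succ n => rw [commutatorSeq_add_two]; exact key _ _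

theorem slTrace_commutatorSeq_add_two (a b : SpecialLinearGroup (Fin 2) ℝ) (n : ℕ) :
    slTrace (commutatorSeq a b (n + 2)) - 2 = (slTrace (commutatorSeq a b (n + 1)) - 2) *
      (slTrace (commutatorSeq a b (n + 1)) - 2 - 4 * (slTrace (commutatorSeq a b n) - 2)
        - (slTrace (commutatorSeq a b n) - 2) ^ 2) := by
  rw [commutatorSeq_add_two, slTrace_commutator, slTrace_inv_mul_commutatorSeq]
  ring

/-- For the recursion satisfied by the traces (minus two) of iterated commutators, no two
consecutive terms are negative. -/
theorem pos_or_pos_of_trace_recursion {g : ℕ → ℝ}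
    (hg : ∀ n, g (n + 2) = g (n + 1) * (g (n + 1) - 4 * g n - g n ^ 2))
    (h0 : 0 < g 0) (h0' : g 0 ≤ 1 / 8) (h1 : g 1 ≠ 0) (h1' : |g 1| < g 0) (n : ℕ) :
    0 < g n ∨ 0 < g (n + 1) := by
  suffices h : g n ≠ 0 ∧ |g n| ≤ 1 / 8 ∧ g (n + 1) ≠ 0 ∧ |g (n + 1)| < |g n| ∧
      (0 < g n ∨ 0 < g (n + 1)) from h.2.2.2.2
  induction n with
  | zero => exact ⟨h0.ne', by rwa [abs_of_pos h0], h1, by rwa [abs_of_pos h0], Or.inl h0⟩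
  | succ n ih =>
    obtain ⟨hn, hn8, hn1, hlt, hpos⟩ := ih
    rw [hg n]
    generalize g n = x at *
    generalize g (n + 1) = y at *
    have hx2 : x ^ 2 ≤ |x| / 8 := by
      rw [← sq_abs]; nlinarith [abs_nonneg x]
    have hx0 : 0 < |x| := abs_pos.2 hn
    have hyabs := abs_lt.1 hlt
    have hx2' : 0 ≤ x ^ 2 := sq_nonneg x
    rcases lt_or_gt_of_ne hn with hx | hx
    -- The factor y - 4x - x² has the sign of -x because |y| < |x|, and absolute value below 1
    -- because |x| ≤ 1/8. So a negative y preceded by a positive x is followed by a positive term,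
    -- and the absolute values keep decreasing.
    · rw [abs_of_neg hx] at *
      have hy : 0 < y := hpos.resolve_left (not_lt.2 hx.le)
      have hf : 0 < y - 4 * x - x ^ 2 := by linarith
      refine ⟨hn1, by linarith, (mul_pos hy hf).ne', ?_, Or.inl hy⟩
      rw [abs_mul, abs_of_pos hf]
      exact mul_lt_of_lt_one_right (abs_pos.2 hn1) (by linarith)
    · rw [abs_of_pos hx] at *
      have hf : y - 4 * x - x ^ 2 < 0 := by linarith
      refine ⟨hn1, by linarith, mul_ne_zero hn1 hf.ne, ?_, ?_⟩
      · rw [abs_mul, abs_of_neg hf]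
        exact mul_lt_of_lt_one_right (abs_pos.2 hn1) (by linarith)
      · rcases lt_or_gt_of_ne hn1 with hy | hy
        · exact Or.inr (mul_pos_of_neg_of_neg hy hf)
        · exact Or.inl hy

end Trace

/-! ### Vectors of the plane and eigenvectors -/

section PlaneVectors

/-- The linear action of `SL(2, ℝ)` on the plane. -/
def slAct (X : SpecialLinearGroup (Fin 2) ℝ) (v : Fin 2 → ℝ) : Fin 2 → ℝ :=
  ![X 0 0 * v 0 + X 0 1 * v 1, X 1 0 * v 0 + X 1 1 * v 1]

theorem slAct_zero (X : SpecialLinearGroup (Fin 2) ℝ) (v : Fin 2 → ℝ) :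
    slAct X v 0 = X 0 0 * v 0 + X 0 1 * v 1 := rfl

theorem slAct_one (X : SpecialLinearGroup (Fin 2) ℝ) (v : Fin 2 → ℝ) :
    slAct X v 1 = X 1 0 * v 0 + X 1 1 * v 1 := rfl

theorem slAct_eq_mulVec (X : SpecialLinearGroup (Fin 2) ℝ) (v : Fin 2 → ℝ) :
    slAct X v = X.1.mulVec v := by
  ext i
  fin_cases i <;> simp [slAct, Matrix.mulVec, dotProduct, Fin.sum_univ_two]

theorem slAct_mul (X Y : SpecialLinearGroup (Fin 2) ℝ) (v : Fin 2 → ℝ) :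
    slAct (X * Y) v = slAct X (slAct Y v) := by
  simp only [slAct_eq_mulVec, Matrix.mulVec_mulVec]
  rfl

theorem one_slAct (v : Fin 2 → ℝ) : slAct 1 v = v := by
  rw [slAct_eq_mulVec]; exact Matrix.one_mulVec v

theorem slAct_smul (X : SpecialLinearGroup (Fin 2) ℝ) (c : ℝ) (v : Fin 2 → ℝ) :
    slAct X (c • v) = c • slAct X v := by
  simp only [slAct_eq_mulVec, Matrix.mulVec_smul]

theorem slAct_ne_zero (X : SpecialLinearGroup (Fin 2) ℝ) {v : Fin 2 → ℝ} (hv : v ≠ 0) :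
    slAct X v ≠ 0 := by
  intro h
  apply hv
  rw [← one_slAct v, ← inv_mul_cancel X, slAct_mul, h, slAct_eq_mulVec, Matrix.mulVec_zero]

/-- The determinant of a pair of vectors of the plane. -/
def wedge (u v : Fin 2 → ℝ) : ℝ := u 0 * v 1 - u 1 * v 0

theorem wedge_comm (u v : Fin 2 → ℝ) : wedge u v = -wedge v u := by
  simp only [wedge]; ring

theorem wedge_smul_left (c : ℝ) (u v : Fin 2 → ℝ) : wedge (c • u) v = c * wedge u v := by
  simp only [wedge, Pi.smul_apply, smul_eq_mul]; ring

theorem wedge_smul_right (c : ℝ) (u v : Fin 2 → ℝ) : wedge u (c • v) = c * wedge u v := by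
  simp only [wedge, Pi.smul_apply, smul_eq_mul]; ring

theorem wedge_slAct (X : SpecialLinearGroup (Fin 2) ℝ) (u v : Fin 2 → ℝ) :
    wedge (slAct X u) (slAct X v) = wedge u v := by
  have := det_fin_two_eq_one X
  simp only [wedge, slAct_zero, slAct_one]
  linear_combination (u 0 * v 1 - u 1 * v 0) * this

theorem exists_smul_of_wedge_eq_zero {u v : Fin 2 → ℝ} (hv : v ≠ 0) (h : wedge u v = 0) :
    ∃ c : ℝ, u = c • v := by
  simp only [wedge] at h
  by_cases h0 : v 0 = 0
  · have h1 : v 1 ≠ 0 := fun h1 => hv (by ext i; fin_cases i <;> simp [h0, h1])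
    refine ⟨u 1 / v 1, ?_⟩
    have : u 0 = 0 := by
      rw [h0] at h
      simpa [h1] using h
    ext i; fin_cases i <;> simp [h0, h1, this]
  · refine ⟨u 0 / v 0, ?_⟩
    ext i; fin_cases i
    · simp [h0]
    · simp only [Fin.mk_one, Pi.smul_apply, smul_eq_mul]
      field_simp
      linarith

theorem slAct_eigen_root {X : SpecialLinearGroup (Fin 2) ℝ} {v : Fin 2 → ℝ} (hv : v ≠ 0) {μ : ℝ}
    (h : slAct X v = μ • v) : μ * μ - slTrace X * μ + 1 = 0 := by
  have h0 := congrFun h 0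
  have h1 := congrFun h 1
  have hd := det_fin_two_eq_one X
  simp only [slAct_zero, slAct_one, Pi.smul_apply, smul_eq_mul] at h0 h1
  have e0 : (μ * μ - slTrace X * μ + 1) * v 0 = 0 := by
    rw [slTrace]; linear_combination (X 1 1 - μ) * h0 - X 0 1 * h1 - v 0 * hd
  have e1 : (μ * μ - slTrace X * μ + 1) * v 1 = 0 := by
    rw [slTrace]; linear_combination (X 0 0 - μ) * h1 - X 1 0 * h0 - v 1 * hd
  by_contra hne
  apply hv
  ext i
  fin_cases i
  · simpa [hne] using e0
  · simpa [hne] using e1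

theorem exists_eigenvector_of_root {X : SpecialLinearGroup (Fin 2) ℝ} {μ : ℝ}
    (h : μ * μ - slTrace X * μ + 1 = 0) : ∃ v : Fin 2 → ℝ, v ≠ 0 ∧ slAct X v = μ • v := by
  have hd := det_fin_two_eq_one X
  have : (X.1 - μ • (1 : Matrix (Fin 2) (Fin 2) ℝ)).det = 0 := by
    rw [Matrix.det_fin_two]
    simp only [Matrix.sub_apply, Matrix.smul_apply, Matrix.one_apply_eq, smul_eq_mul,
      Matrix.one_apply_ne (show (0 : Fin 2) ≠ 1 by decide),
      Matrix.one_apply_ne (show (1 : Fin 2) ≠ 0 by decide)]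
    rw [slTrace] at h
    linear_combination h + hd
  obtain ⟨v, hv, hv'⟩ := Matrix.exists_mulVec_eq_zero_iff.2 this
  refine ⟨v, hv, ?_⟩
  rw [Matrix.sub_mulVec, Matrix.smul_mulVec, Matrix.one_mulVec, sub_eq_zero] at hv'
  rw [slAct_eq_mulVec, hv']

theorem exists_root_of_two_lt {t : ℝ} (ht : 2 < t) : ∃ μ : ℝ, 1 < μ ∧ μ * μ - t * μ + 1 = 0 := by
  have hs : √(t ^ 2 - 4) ^ 2 = t ^ 2 - 4 := Real.sq_sqrt (by nlinarith)
  have := Real.sqrt_nonneg (t ^ 2 - 4)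
  exact ⟨(t + √(t ^ 2 - 4)) / 2, by linarith, by linear_combination hs / 4⟩

/-- Two independent eigenvectors for the same μ would give determinant μ² = 1, hence μ = ±1 and
trace ±2. -/
theorem wedge_eq_zero_of_eigen {X : SpecialLinearGroup (Fin 2) ℝ} (hX : 2 < slTrace X)
    {u v : Fin 2 → ℝ} (hu : u ≠ 0) {μ : ℝ} (h : slAct X u = μ • u) (h' : slAct X v = μ • v) :
    wedge u v = 0 := by
  have h1 := slAct_eigen_root hu h
  have h2 := wedge_slAct X u v
  rw [h, h', wedge_smul_left, wedge_smul_right] at h2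
  by_contra hne
  have h3 : μ * μ = 1 := by
    apply mul_right_cancel₀ hne; linarith
  rcases mul_self_eq_one_iff.1 h3 with rfl | rfl <;> linarith

end PlaneVectors

/-! ### Ping-pong on cones in the plane -/

section PingPong

/-- The product of the letters `A`, `B` spelled by a list. -/
def spell {L : Type*} [Group L] (A B : L) (l : List Bool) : L :=
  (l.map fun c => cond c A B).prod

theorem spell_mem_wordBall {L : Type*} [Group L] {A B : L} {S : Set L} {k : ℕ}
    (hA : A ∈ wordBall S k) (hB : B ∈ wordBall S k) (l : List Bool) :
    spell A B l ∈ wordBall S (l.length * k) := by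
  have := list_prod_mem_wordBall (S := S) (k := k) (l.map fun c => cond c A B) (by
    intro x hx
    obtain ⟨c, -, rfl⟩ := List.mem_map.1 hx
    cases c
    exacts [hB, hA])
  rwa [List.length_map] at this

variable {A B : SpecialLinearGroup (Fin 2) ℝ} {J : Set (Fin 2 → ℝ)}

theorem spell_slAct_mem (hA : ∀ v ∈ J, slAct A v ∈ J) (hB : ∀ v ∈ J, slAct B v ∈ J)
    (l : List Bool) {v : Fin 2 → ℝ} (hv : v ∈ J) : slAct (spell A B l) v ∈ J := by
  induction l with
  | nil => simpa [spell, one_slAct] using hv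
  | cons c l ih =>
    rw [spell, List.map_cons, List.prod_cons, slAct_mul]
    cases c
    exacts [hB _ ih, hA _ ih]

/-- Common leading letters can be stripped since the determinant of two vectors is invariant; at the
first different letter the images of `J` are transverse. -/
theorem eq_of_wedge_spell_eq_zero (hA : ∀ v ∈ J, slAct A v ∈ J) (hB : ∀ v ∈ J, slAct B v ∈ J)
    (hAB : ∀ u ∈ J, ∀ v ∈ J, wedge (slAct A u) (slAct B v) ≠ 0) {v : Fin 2 → ℝ} (hv : v ∈ J)
    (l l' : List Bool) (hl : l.length = l'.length)
    (h : wedge (slAct (spell A B l) v) (slAct (spell A B l') v) = 0) : l = l' := by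
  induction l generalizing l' with
  | nil => exact (List.length_eq_zero_iff.1 hl.symm).symm
  | cons c l ih =>
    cases l' with
    | nil => simp at hl
    | cons c' l' =>
      have e : ∀ (c : Bool) (l : List Bool), slAct (spell A B (c :: l)) v =
          slAct (cond c A B) (slAct (spell A B l) v) := fun c l => by
        rw [spell, List.map_cons, List.prod_cons, slAct_mul]; rfl
      rw [e, e] at h
      have m := spell_slAct_mem hA hB l hv
      have m' := spell_slAct_mem hA hB l' hv
      have hc : c = c' := by
        cases c <;> cases c'
        · rfl
        · rw [wedge_comm, neg_eq_zero] at h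
          exact absurd h (hAB _ m' _ m)
        · exact absurd h (hAB _ m _ m')
        · rfl
      subst hc
      rw [wedge_slAct] at h
      rw [ih l' (by simpa using hl) h]

theorem pow_entries_of_diagonal {b : SpecialLinearGroup (Fin 2) ℝ} {lam : ℝ} (h00 : b 0 0 = lam)
    (h01 : b 0 1 = 0) (h10 : b 1 0 = 0) (h11 : b 1 1 = lam⁻¹) (n : ℕ) :
    (b ^ n) 0 0 = lam ^ n ∧ (b ^ n) 0 1 = 0 ∧ (b ^ n) 1 0 = 0 ∧ (b ^ n) 1 1 = (lam ^ n)⁻¹ := by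
  induction n with
  | zero => simp
  | succ n ih =>
    obtain ⟨i1, i2, i3, i4⟩ := ih
    simp only [pow_succ b, mul_entry, i1, i2, i3, i4, h00, h01, h10, h11]
    refine ⟨by ring, by ring, by ring, by rw [pow_succ, mul_inv]; ring⟩

/-- The cone of vectors of slope at most `K`. -/
def slopeCone (K : ℝ) : Set (Fin 2 → ℝ) := {v | v 0 ≠ 0 ∧ |v 1| ≤ K * |v 0|}

theorem abs_mul_add_mul_le {p q x y P Q X Y : ℝ} (hp : |p| ≤ P) (hq : |q| ≤ Q) (hx : |x| ≤ X)
    (hy : |y| ≤ Y) : |p * x + q * y| ≤ P * X + Q * Y := by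
  refine (abs_add_le _ _).trans (add_le_add ?_ ?_) <;> rw [abs_mul] <;>
    exact mul_le_mul ‹_› ‹_› (abs_nonneg _) ((abs_nonneg _).trans ‹_›)

theorem le_abs_mul_add_mul {p q x y P Q X Y : ℝ} (hp : P ≤ |p|) (hq : |q| ≤ Q) (hx : X ≤ |x|)
    (hX : 0 ≤ X) (hy : |y| ≤ Y) : P * X - Q * Y ≤ |p * x + q * y| := by
  have h1 : |p * x| - |q * y| ≤ |p * x + q * y| := by
    have := abs_sub_abs_le_abs_sub (p * x) (-(q * y))
    rwa [abs_neg, sub_neg_eq_add] at this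
  rw [abs_mul, abs_mul] at h1
  have h2 : P * X ≤ |p| * |x| := mul_le_mul hp hx hX (abs_nonneg _)
  have h3 : |q| * |y| ≤ Q * Y := mul_le_mul hq hy (abs_nonneg _) ((abs_nonneg _).trans hq)
  linarith

/-- A high power of b flattens the cone of slope at most K to slopes at most |a 1 0| / 4. Then a
tilts these to slopes between |a 1 0| / 2 and 1, which lie again in the cone but are disjoint from
the flat ones. -/
theorem exists_pingPong {a b : SpecialLinearGroup (Fin 2) ℝ} {lam : ℝ} (hlam : 1 < lam)
    (h00 : b 0 0 = lam) (h01 : b 0 1 = 0) (h10 : b 1 0 = 0) (h11 : b 1 1 = lam⁻¹)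
    (ha : ∀ i j, |a i j - (1 : Matrix (Fin 2) (Fin 2) ℝ) i j| ≤ 1 / 64)
    (hq : a 0 1 ≠ 0) (hr : a 1 0 ≠ 0) :
    ∃ (N : ℕ) (J : Set (Fin 2 → ℝ)), (∀ v ∈ J, slAct (b ^ N) v ∈ J) ∧
      (∀ v ∈ J, slAct (a * b ^ N) v ∈ J) ∧
      (∀ u ∈ J, ∀ v ∈ J, wedge (slAct (b ^ N) u) (slAct (a * b ^ N) v) ≠ 0) ∧
      ∀ v, v ≠ 0 → v ∈ J ∨ slAct a v ∈ J := by
  have ha00 := ha 0 0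
  have ha01 := ha 0 1
  have ha10 := ha 1 0
  have ha11 := ha 1 1
  simp only [Matrix.one_apply_eq, Matrix.one_apply_ne (show (0 : Fin 2) ≠ 1 by decide),
    Matrix.one_apply_ne (show (1 : Fin 2) ≠ 0 by decide), sub_zero] at ha00 ha01 ha10 ha11
  have hq0 : 0 < |a 0 1| := abs_pos.2 hq
  have hr0 : 0 < |a 1 0| := abs_pos.2 hr
  have hp1 : 63 / 64 ≤ |a 0 0| := by
    rw [abs_le] at ha00; rw [abs_of_pos] <;> linarith
  have hp2 : |a 0 0| ≤ 65 / 64 := by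
    rw [abs_le] at ha00 ⊢; constructor <;> linarith
  have hs2 : |a 1 1| ≤ 65 / 64 := by
    rw [abs_le] at ha11 ⊢; constructor <;> linarith
  -- Outside the cone, |v 0| ≤ |a 0 1| |v 1| / 3, so the term a 0 1 * v 1 dominates the first
  -- coordinate of the image under a. The numerator 3 leaves enough room for that image to lie in
  -- the cone.
  obtain ⟨K, hK⟩ : ∃ K : ℝ, K = 3 / |a 0 1| := ⟨_, rfl⟩
  have hKq : K * |a 0 1| = 3 := by rw [hK]; field_simp
  have hK1 : 192 ≤ K := by
    rw [hK, le_div_iff₀ hq0]; linarith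
  obtain ⟨N, hN⟩ := pow_unbounded_of_one_lt (K * 4 / |a 1 0|) hlam
  have hL1 : 1 ≤ lam ^ N := one_le_pow₀ hlam.le
  obtain ⟨p1, p2, p3, p4⟩ := pow_entries_of_diagonal h00 h01 h10 h11 N
  have hA0 : ∀ v, slAct (b ^ N) v 0 = lam ^ N * v 0 := fun v => by
    rw [slAct_zero, p1, p2]; ring
  have hA1 : ∀ v, slAct (b ^ N) v 1 = (lam ^ N)⁻¹ * v 1 := fun v => by
    rw [slAct_one, p3, p4]; ring
  have hA : ∀ v ∈ slopeCone K, slAct (b ^ N) v ∈ slopeCone (|a 1 0| / 4) := by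
    intro v hv
    have hL0 : 0 < lam ^ N := by linarith
    refine ⟨by rw [hA0]; exact mul_ne_zero hL0.ne' hv.1, ?_⟩
    rw [hA0, hA1, abs_mul, abs_mul, abs_of_pos hL0, abs_of_pos (inv_pos.2 hL0)]
    have h1 : (lam ^ N)⁻¹ * |v 1| ≤ |v 1| :=
      mul_le_of_le_one_left (abs_nonneg _) (inv_le_one_of_one_le₀ hL1)
    have h2 : K ≤ |a 1 0| / 4 * lam ^ N := by
      rw [div_lt_iff₀ hr0] at hN; linarith
    calc _ ≤ K * |v 0| := h1.trans hv.2
      _ ≤ |a 1 0| / 4 * lam ^ N * |v 0| := mul_le_mul_of_nonneg_right h2 (abs_nonneg _)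
      _ = _ := by ring
  have ha' : ∀ u ∈ slopeCone (|a 1 0| / 4), slAct a u 0 ≠ 0 ∧
      |slAct a u 1| ≤ |slAct a u 0| ∧ |a 1 0| / 2 * |slAct a u 0| ≤ |slAct a u 1| := by
    intro u hu
    have hu0 : 0 < |u 0| := abs_pos.2 hu.1
    have hu1 : |u 1| ≤ 1 / 256 * |u 0| :=
      hu.2.trans (mul_le_mul_of_nonneg_right (by linarith) hu0.le)
    have b1 := le_abs_mul_add_mul hp1 ha01 le_rfl hu0.le hu1
    have b2 := abs_mul_add_mul_le hp2 ha01 (le_refl |u 0|) hu1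
    have b3 := le_abs_mul_add_mul (le_refl |a 1 0|) hs2 le_rfl hu0.le hu.2
    have b4 := abs_mul_add_mul_le ha10 hs2 (le_refl |u 0|) hu1
    rw [slAct_zero, slAct_one]
    refine ⟨abs_pos.1 (by linarith), by linarith, ?_⟩
    have b5 := mul_le_mul_of_nonneg_left b2 hr0.le
    have b6 : 0 < |a 1 0| * |u 0| := mul_pos hr0 hu0
    linarith
  refine ⟨N, slopeCone K, ?_, ?_, ?_, ?_⟩
  · intro v hv
    have := hA v hv
    exact ⟨this.1, this.2.trans (mul_le_mul_of_nonneg_right (by linarith) (abs_nonneg _))⟩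
  · intro v hv
    rw [slAct_mul]
    obtain ⟨c1, c2, -⟩ := ha' _ (hA v hv)
    exact ⟨c1, c2.trans (le_mul_of_one_le_left (abs_nonneg _) (by linarith))⟩
  · intro u hu v hv h
    rw [slAct_mul] at h
    obtain ⟨c1, -, c3⟩ := ha' _ (hA v hv)
    obtain ⟨d1, d2⟩ := hA u hu
    generalize slAct a (slAct (b ^ N) v) = y at *
    generalize slAct (b ^ N) u = x at *
    have e : |x 0| * |y 1| = |x 1| * |y 0| := by
      rw [← abs_mul, ← abs_mul]; rw [wedge, sub_eq_zero] at h; rw [h]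
    have hx : 0 < |x 0| := abs_pos.2 d1
    have hy : 0 < |y 0| := abs_pos.2 c1
    have e1 := mul_le_mul_of_nonneg_left c3 hx.le
    have e2 := mul_le_mul_of_nonneg_right d2 hy.le
    have e3 : 0 < |a 1 0| * |x 0| * |y 0| := by positivity
    nlinarith
  · intro v hv
    by_cases hvJ : v ∈ slopeCone K
    · exact Or.inl hvJ
    · right
      have h1 : K * |v 0| ≤ |v 1| := by
        by_cases h0 : v 0 = 0
        · simp [h0]
        · by_contra hlt
          exact hvJ ⟨h0, (not_le.1 hlt).le⟩
      have h2 : 0 < |v 1| := by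
        rw [abs_pos]
        intro h2
        rw [h2, abs_zero] at h1
        have : |v 0| = 0 := le_antisymm (by nlinarith [abs_nonneg (v 0)]) (abs_nonneg _)
        exact hv (by ext i; fin_cases i <;> simp [h2, abs_eq_zero.1 this])
      have h3 : |v 0| ≤ 1 / 3 * |a 0 1| * |v 1| := by
        have := mul_le_mul_of_nonneg_left h1 hq0.le
        nlinarith
      have h3' : |v 0| ≤ 1 / 192 * |v 1| := h3.trans
        (mul_le_mul_of_nonneg_right (by linarith) h2.le)
      have b1 := le_abs_mul_add_mul (le_refl |a 0 1|) hp2 (le_refl |v 1|) h2.le h3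
      have b2 := abs_mul_add_mul_le ha10 hs2 h3' (le_refl |v 1|)
      have b3 : 0 < |a 0 1| * |v 1| := mul_pos hq0 h2
      rw [add_comm (a 0 1 * v 1)] at b1
      refine ⟨?_, ?_⟩
      · rw [slAct_zero, ← abs_pos]; nlinarith
      · rw [slAct_zero, slAct_one]
        have b4 := mul_le_mul_of_nonneg_left b1 (show 0 ≤ K by linarith)
        have b5 : K * (|a 0 1| * |v 1| - 65 / 64 * (1 / 3 * |a 0 1| * |v 1|)) =
          3 * (1 - 65 / 192) * |v 1| := by
          linear_combination (1 - 65 / 192) * |v 1| * hKq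
        linarith

end PingPong

/-! ### Norm growth under products and conjugation -/

section NormBound

attribute [local instance] Matrix.linftyOpNormedRing Matrix.linfty_opNormOneClass

/-- `X` and its inverse have operator norm at most `R`. -/
def NormBounded (R : ℝ) (X : SpecialLinearGroup (Fin 2) ℝ) : Prop :=
  ‖(X : Matrix (Fin 2) (Fin 2) ℝ)‖ ≤ R ∧ ‖((X⁻¹ : SpecialLinearGroup (Fin 2) ℝ) :
    Matrix (Fin 2) (Fin 2) ℝ)‖ ≤ R

theorem NormBounded.mono {R R' : ℝ} {X : SpecialLinearGroup (Fin 2) ℝ} (h : NormBounded R X)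
    (hR : R ≤ R') : NormBounded R' X :=
  ⟨h.1.trans hR, h.2.trans hR⟩

theorem normBounded_one : NormBounded 1 1 := by
  simp [NormBounded]

theorem NormBounded.mul {R R' : ℝ} {X Y : SpecialLinearGroup (Fin 2) ℝ} (hX : NormBounded R X)
    (hY : NormBounded R' Y) : NormBounded (R * R') (X * Y) := by
  constructor
  · rw [Matrix.SpecialLinearGroup.coe_mul]
    exact (norm_mul_le _ _).trans
      (mul_le_mul hX.1 hY.1 (norm_nonneg _) ((norm_nonneg _).trans hX.1))
  · rw [mul_inv_rev, Matrix.SpecialLinearGroup.coe_mul, mul_comm R R']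
    exact (norm_mul_le _ _).trans
      (mul_le_mul hY.2 hX.2 (norm_nonneg _) ((norm_nonneg _).trans hY.2))

theorem exists_normBounded (X : SpecialLinearGroup (Fin 2) ℝ) : ∃ R, NormBounded R X :=
  ⟨_, le_max_left _ _, le_max_right _ _⟩

theorem NormBounded.spell {R : ℝ} {A B : SpecialLinearGroup (Fin 2) ℝ} (hA : NormBounded R A)
    (hB : NormBounded R B) (l : List Bool) : NormBounded (R ^ l.length) (spell A B l) := by
  induction l with
  | nil => simpa [_root_.spell] using normBounded_one
  | cons c l ih =>
    have : _root_.spell A B (c :: l) = cond c A B * _root_.spell A B l := by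
      simp [_root_.spell]
    rw [this, List.length_cons, pow_succ']
    refine NormBounded.mul ?_ ih
    cases c
    exacts [hB, hA]

theorem NearOne.conj_entry_le {R r : ℝ} {g p : SpecialLinearGroup (Fin 2) ℝ}
    (hp : NearOne r p) (hg : NormBounded R g) (i j : Fin 2) :
    |(g * p * g⁻¹) i j - (1 : Matrix (Fin 2) (Fin 2) ℝ) i j| ≤ R ^ 2 * r := by
  have hR : 0 ≤ R := (norm_nonneg _).trans hg.1
  have hr : 0 ≤ r := (norm_nonneg _).trans hp.1
  have e : ((g * p * g⁻¹ : SpecialLinearGroup (Fin 2) ℝ) : Matrix (Fin 2) (Fin 2) ℝ) - 1 =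
      g.1 * (p.1 - 1) * (g⁻¹).1 := by
    have h1 : g.1 * (g⁻¹).1 = 1 := by
      rw [← Matrix.SpecialLinearGroup.coe_mul, mul_inv_cancel, Matrix.SpecialLinearGroup.coe_one]
    rw [mul_sub, sub_mul, mul_one, h1, Matrix.SpecialLinearGroup.coe_mul,
      Matrix.SpecialLinearGroup.coe_mul]
  have h := norm_entry_le (((g * p * g⁻¹ : SpecialLinearGroup (Fin 2) ℝ) :
    Matrix (Fin 2) (Fin 2) ℝ) - 1) i j
  rw [Matrix.sub_apply] at h
  refine h.trans ?_
  rw [e]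
  calc _ ≤ ‖g.1‖ * ‖p.1 - 1‖ * ‖(g⁻¹).1‖ :=
        (norm_mul_le _ _).trans (mul_le_mul_of_nonneg_right (norm_mul_le _ _) (norm_nonneg _))
    _ ≤ R * r * R := mul_le_mul (mul_le_mul hg.1 hp.1 (norm_nonneg _) hR) hg.2 (norm_nonneg _)
        (by positivity)
    _ = R ^ 2 * r := by ring

end NormBound

/-! ### Counting small hyperbolic conjugates -/

section Counting

theorem slTrace_conj (g p : SpecialLinearGroup (Fin 2) ℝ) :
    slTrace (g * p * g⁻¹) = slTrace p := by
  rw [slTrace_mul_comm, inv_mul_cancel_left]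

theorem slAct_conj_eigen {g p : SpecialLinearGroup (Fin 2) ℝ} {v : Fin 2 → ℝ} {μ : ℝ}
    (h : slAct p v = μ • v) : slAct (g * p * g⁻¹) (slAct g v) = μ • slAct g v := by
  rw [← slAct_mul, inv_mul_cancel_right, slAct_mul, h, slAct_smul]

/-- Conjugating a hyperbolic element by the words of length `m` in ping-pong players gives `2 ^ m`
distinct elements, up to one preliminary conjugation. -/
theorem exists_injective_conj {a A B p : SpecialLinearGroup (Fin 2) ℝ} {J : Set (Fin 2 → ℝ)}
    (hA : ∀ v ∈ J, slAct A v ∈ J) (hB : ∀ v ∈ J, slAct B v ∈ J)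
    (hAB : ∀ u ∈ J, ∀ v ∈ J, wedge (slAct A u) (slAct B v) ≠ 0)
    (ha : ∀ v, v ≠ 0 → v ∈ J ∨ slAct a v ∈ J) (hp : 2 < slTrace p) (m : ℕ) :
    ∃ t : SpecialLinearGroup (Fin 2) ℝ, (t = 1 ∨ t = a) ∧
      Function.Injective (fun f : Fin m → Bool =>
        (spell A B (List.ofFn f) * t) * p * (spell A B (List.ofFn f) * t)⁻¹) := by
  obtain ⟨μ, -, hμ⟩ := exists_root_of_two_lt hp
  obtain ⟨v, hv, hpv⟩ := exists_eigenvector_of_root hμ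
  -- Ping-pong needs the eigenvector of p to start in `J`; if it does not, one application of a
  -- brings it there.
  obtain ⟨t, ht, htJ⟩ : ∃ t, (t = 1 ∨ t = a) ∧ slAct t v ∈ J := by
    rcases ha v hv with h | h
    · exact ⟨1, Or.inl rfl, by rwa [one_slAct]⟩
    · exact ⟨a, Or.inr rfl, h⟩
  refine ⟨t, ht, fun f f' hff => ?_⟩
  have h1 := slAct_conj_eigen (g := spell A B (List.ofFn f) * t) hpv
  have h2 := slAct_conj_eigen (g := spell A B (List.ofFn f') * t) hpv
  simp only at hff
  rw [← hff] at h2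
  -- Equal conjugates share the eigenline for μ, so the two words send the starting vector to the
  -- same line.
  have h3 := wedge_eq_zero_of_eigen (by rwa [slTrace_conj]) (slAct_ne_zero _ hv) h1 h2
  rw [slAct_mul, slAct_mul] at h3
  exact List.ofFn_injective (eq_of_wedge_spell_eq_zero hA hB hAB htJ _ _ (by simp) h3)

theorem fib_succ_le_two_pow (n : ℕ) : Nat.fib (n + 1) ≤ 2 ^ n := by
  induction n using Nat.twoStepInduction with
  | zero => simp
  | one => simp
  | more n h0 h1 =>
    rw [Nat.fib_add_two (n := n + 1)]
    have : 2 ^ (n + 2) = 4 * 2 ^ n := by ring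
    have : 2 ^ (n + 1) = 2 * 2 ^ n := by ring
    omega

theorem pow_le_two_mul_fib (n : ℕ) : (3 / 2 : ℝ) ^ n ≤ 2 * Nat.fib (n + 1) := by
  induction n using Nat.twoStepInduction with
  | zero => norm_num
  | one => norm_num
  | more n h0 h1 =>
    rw [Nat.fib_add_two (n := n + 1)]
    push_cast
    have : (0 : ℝ) < (3 / 2) ^ n := by positivity
    rw [pow_succ] at h1 ⊢
    rw [pow_succ]
    linarith

/-- Before rounding, the quotient is at least (3/2)^i / (8c). Once (3/2)^i ≥ 16c, the loss of at
most 1 from rounding down costs at most half of this. -/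
theorem eventually_le_fib_div (c : ℕ) (hc : 0 < c) :
    ∀ᶠ i : ℕ in atTop, 1 / (16 * c : ℝ) * (3 / 2) ^ i ≤ (Nat.fib (i + 1) / (4 * c) : ℕ) := by
  have h1 : Tendsto (fun i : ℕ => (3 / 2 : ℝ) ^ i) atTop atTop :=
    tendsto_pow_atTop_atTop_of_one_lt (by norm_num)
  filter_upwards [h1.eventually_ge_atTop (16 * c)] with i hi
  have hc' : (0 : ℝ) < c := by exact_mod_cast hc
  have h2 := Nat.lt_div_mul_add (a := Nat.fib (i + 1)) (show 0 < 4 * c by omega)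
  have h3 : (Nat.fib (i + 1) : ℝ) < (Nat.fib (i + 1) / (4 * c) : ℕ) * (4 * c) + 4 * c := by
    exact_mod_cast h2
  have h4 := pow_le_two_mul_fib i
  rw [div_mul_eq_mul_div, one_mul, div_le_iff₀ (by positivity)]
  linarith

/-- The initial data of the trace recursion: the first commutator has trace minus 2 equal to a small
multiple of `a 0 1 * a 1 0`, nonzero because a fixes neither axis of the diagonal b. -/
theorem slTrace_commutatorSeq_pos {a b : SpecialLinearGroup (Fin 2) ℝ} {lam : ℝ} (hlam : 1 < lam)
    (hlam' : lam ≤ 1 + 1 / 64)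
    (h00 : b 0 0 = lam) (h01 : b 0 1 = 0) (h10 : b 1 0 = 0) (h11 : b 1 1 = lam⁻¹)
    (ha : ∀ i j, |a i j - (1 : Matrix (Fin 2) (Fin 2) ℝ) i j| ≤ 1 / 64)
    (hq : a 0 1 ≠ 0) (hr : a 1 0 ≠ 0) (n : ℕ) :
    2 < slTrace (commutatorSeq a b n) ∨ 2 < slTrace (commutatorSeq a b (n + 1)) := by
  have hinv : lam * lam⁻¹ = 1 := mul_inv_cancel₀ (by linarith)
  have hinv1 : lam⁻¹ < 1 := inv_lt_one_of_one_lt₀ hlam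
  have ha01 := ha 0 1
  have ha10 := ha 1 0
  simp only [Matrix.one_apply_ne (show (0 : Fin 2) ≠ 1 by decide),
    Matrix.one_apply_ne (show (1 : Fin 2) ≠ 0 by decide), sub_zero] at ha01 ha10
  have g0 : slTrace (commutatorSeq a b 0) - 2 = lam + lam⁻¹ - 2 := by
    rw [commutatorSeq_zero, slTrace, h00, h11]
  have g0pos : 0 < lam + lam⁻¹ - 2 := by nlinarith
  have g0le : lam + lam⁻¹ - 2 ≤ 1 / 8 := by linarith
  have g1 : slTrace (commutatorSeq a b 1) - 2 =
      -((lam + lam⁻¹ - 2) * (lam + lam⁻¹ + 2) * (a 0 1 * a 1 0)) := by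
    have hd := det_fin_two_eq_one a
    obtain ⟨a1, a2, a3, a4⟩ := inv_entry a
    obtain ⟨b1, b2, b3, b4⟩ := inv_entry b
    rw [commutatorSeq_one]
    simp only [slTrace, mul_entry, a1, a2, a3, a4, b1, b2, b3, b4, h00, h01, h10, h11]
    linear_combination (2 * a 0 0 * a 1 1 + 2 * a 0 1 * a 1 0) * hinv + 2 * hd
  have hqr : |a 0 1 * a 1 0| ≤ 1 / 4096 := by
    rw [abs_mul]
    exact (mul_le_mul ha01 ha10 (abs_nonneg _) (by norm_num)).trans (by norm_num)
  have h1 : slTrace (commutatorSeq a b 1) - 2 ≠ 0 := by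
    rw [g1]
    exact neg_ne_zero.2 (mul_ne_zero (mul_ne_zero g0pos.ne' (by linarith)) (mul_ne_zero hq hr))
  have h1' : |slTrace (commutatorSeq a b 1) - 2| < slTrace (commutatorSeq a b 0) - 2 := by
    rw [g1, g0, abs_neg, abs_mul, abs_mul, abs_of_pos g0pos, abs_of_pos (by linarith), mul_assoc]
    refine mul_lt_of_lt_one_right g0pos ?_
    calc _ ≤ (5 : ℝ) * (1 / 4096) :=
          mul_le_mul (by linarith) hqr (abs_nonneg _) (by norm_num)
      _ < 1 := by norm_num
  rw [← g0] at g0pos g0le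
  exact (pos_or_pos_of_trace_recursion (g := fun n => slTrace (commutatorSeq a b n) - 2)
    (slTrace_commutatorSeq_add_two a b) g0pos g0le h1 h1' n).imp sub_pos.1 sub_pos.1

theorem exists_many_near_one {a b : SpecialLinearGroup (Fin 2) ℝ} {lam : ℝ} (hlam : 1 < lam)
    (hlam' : lam ≤ 1 + 1 / 64)
    (h00 : b 0 0 = lam) (h01 : b 0 1 = 0) (h10 : b 1 0 = 0) (h11 : b 1 1 = lam⁻¹)
    (ha : ∀ i j, |a i j - (1 : Matrix (Fin 2) (Fin 2) ℝ) i j| ≤ 1 / 64)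
    (hq : a 0 1 ≠ 0) (hr : a 1 0 ≠ 0) {ε : ℝ} (hε : 0 < ε) :
    ∃ (C : ℕ) (κ : ℝ), 0 < κ ∧ ∀ᶠ i : ℕ in atTop, ∃ F : Finset (SpecialLinearGroup (Fin 2) ℝ),
      (∀ x ∈ F, x ∈ wordBall {a, b} (C * 2 ^ i) ∧
        (∀ j k, |x j k - (1 : Matrix (Fin 2) (Fin 2) ℝ) j k| < ε) ∧ 0 < slTrace x) ∧
      (2 : ℝ) ^ (κ * (3 / 2) ^ i) ≤ F.card := by
  have hinv : lam * lam⁻¹ = 1 := mul_inv_cancel₀ (by linarith)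
  have hinv1 : lam⁻¹ < 1 := inv_lt_one_of_one_lt₀ hlam
  have hinv0 : 0 < lam⁻¹ := inv_pos.2 (by linarith)
  have hbn : NearOne (1 / 32) b := by
    refine (nearOne_of_entry_le (r := 1 / 64) fun i j => ?_).mono (by norm_num)
    fin_cases i <;> fin_cases j
    · simpa [h00, abs_le] using ⟨by linarith, by linarith⟩
    · simp [h01]
    · simp [h10]
    · simp only [Fin.mk_one, h11, Matrix.one_apply_eq, abs_le]
      exact ⟨by nlinarith, by linarith⟩
  have han : NearOne (1 / 32) a := (nearOne_of_entry_le ha).mono (by norm_num)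
  obtain ⟨N, J, hA, hB, hAB, hJ⟩ := exists_pingPong hlam h00 h01 h10 h11 ha hq hr
  obtain ⟨c, hc, hcA, hcB, hca⟩ : ∃ c : ℕ, 0 < c ∧ NormBounded (2 ^ c) (b ^ N) ∧
      NormBounded (2 ^ c) (a * b ^ N) ∧ NormBounded (2 ^ c) a := by
    obtain ⟨R1, hR1⟩ := exists_normBounded (b ^ N)
    obtain ⟨R2, hR2⟩ := exists_normBounded (a * b ^ N)
    obtain ⟨R3, hR3⟩ := exists_normBounded a
    have h : Tendsto (fun c : ℕ => (2 : ℝ) ^ c) atTop atTop :=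
      tendsto_pow_atTop_atTop_of_one_lt (by norm_num)
    obtain ⟨c, h1, h2, h3, h4⟩ := ((h.eventually_ge_atTop R1).and ((h.eventually_ge_atTop R2).and
      ((h.eventually_ge_atTop R3).and (eventually_gt_atTop 0)))).exists
    exact ⟨c, h4, hR1.mono h1, hR2.mono h2, hR3.mono h3⟩
  have hc' : (0 : ℝ) < c := by exact_mod_cast hc
  have hev := eventually_le_fib_div c hc
  have hm : Tendsto (fun i : ℕ => Nat.fib (i + 1) / (4 * c)) atTop atTop := by
    rw [← tendsto_natCast_atTop_iff (R := ℝ)]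
    refine tendsto_atTop_mono' _ hev (Tendsto.const_mul_atTop (by positivity) ?_)
    exact tendsto_pow_atTop_atTop_of_one_lt (by norm_num)
  have hsmall : ∀ᶠ i : ℕ in atTop,
      (2 ^ c) ^ 2 * (1 / 2 : ℝ) ^ (Nat.fib (i + 1) / (4 * c)) < ε := by
    have h := ((tendsto_pow_atTop_nhds_zero_of_lt_one (r := (1 / 2 : ℝ)) (by norm_num)
      (by norm_num)).comp hm).const_mul ((2 ^ c : ℝ) ^ 2)
    rw [mul_zero] at h
    exact h.eventually_lt_const hε
  -- A conjugator has length at most m(N + 1) + 1 and p at most 6 · 2^i; with m ≤ 2^i the total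
  -- 2(m(N + 1) + 1) + 6 · 2^i is at most (2N + 10) · 2^i.
  refine ⟨2 * N + 10, 1 / (16 * c), by positivity, ?_⟩
  filter_upwards [hev, hsmall] with i hi hsi
  obtain ⟨m, hmdef⟩ : ∃ m, m = Nat.fib (i + 1) / (4 * c) := ⟨_, rfl⟩
  rw [← hmdef] at hi hsi
  have hm4 : m * (4 * c) ≤ Nat.fib (i + 1) := hmdef ▸ Nat.div_mul_le_self _ _
  have hmi : m ≤ 2 ^ i :=
    (le_trans (Nat.le_mul_of_pos_right _ (by omega)) hm4).trans (fib_succ_le_two_pow i)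
  obtain ⟨p, hp2, hpw, hpn⟩ : ∃ p : SpecialLinearGroup (Fin 2) ℝ, 2 < slTrace p ∧
      p ∈ wordBall {a, b} (6 * 2 ^ i) ∧ NearOne ((1 / 2) ^ Nat.fib (i + 1)) p := by
    have hpos : (0 : ℝ) < (1 / 2) ^ Nat.fib (i + 1) := by positivity
    -- Either index i or i + 1 serves; the latter doubles the length 3 · 2^i, and its element is at
    -- least as small.
    rcases slTrace_commutatorSeq_pos hlam hlam' h00 h01 h10 h11 ha hq hr i with h | h
    · refine ⟨_, h, wordBall_mono _ ?_ (commutatorSeq_mem_wordBall a b i),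
        (nearOne_commutatorSeq han hbn i).mono (by linarith)⟩
      omega
    · refine ⟨_, h, wordBall_mono _ ?_ (commutatorSeq_mem_wordBall a b (i + 1)),
        (nearOne_commutatorSeq han hbn (i + 1)).mono ?_⟩
      · rw [pow_succ]; omega
      · have : (1 / 2 : ℝ) ^ Nat.fib (i + 1 + 1) ≤ (1 / 2) ^ Nat.fib (i + 1) :=
          pow_le_pow_of_le_one (by norm_num) (by norm_num) (Nat.fib_mono (by omega))
        linarith
  obtain ⟨t, ht, hinj⟩ := exists_injective_conj hA hB hAB hJ hp2 m
  have hta : t ∈ wordBall {a, b} 1 := by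
    rcases ht with rfl | rfl
    exacts [one_mem_wordBall _ _, mem_wordBall_one (by simp)]
  have htn : NormBounded (2 ^ c) t := by
    rcases ht with rfl | rfl
    exacts [normBounded_one.mono (one_le_pow₀ one_le_two), hca]
  have hAw : b ^ N ∈ wordBall {a, b} (N + 1) :=
    wordBall_mono _ (by omega) (pow_mem_wordBall (mem_wordBall_one (by simp)) N)
  have hBw : a * b ^ N ∈ wordBall {a, b} (N + 1) := by
    rw [add_comm N 1]
    exact mul_mem_wordBall (mem_wordBall_one (by simp))
      (wordBall_mono _ (mul_one N).le (pow_mem_wordBall (mem_wordBall_one (by simp)) N))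
  classical
  refine ⟨Finset.univ.image fun f : Fin m → Bool =>
    (spell (b ^ N) (a * b ^ N) (List.ofFn f) * t) * p *
      (spell (b ^ N) (a * b ^ N) (List.ofFn f) * t)⁻¹, ?_, ?_⟩
  · intro x hx
    obtain ⟨f, -, rfl⟩ := Finset.mem_image.1 hx
    have hsw := spell_mem_wordBall hAw hBw (List.ofFn f)
    have hsn := NormBounded.spell hcA hcB (List.ofFn f)
    rw [List.length_ofFn] at hsw hsn
    have hgw := mul_mem_wordBall hsw hta
    have hgn := hsn.mul htn
    refine ⟨wordBall_mono _ ?_ (mul_mem_wordBall (mul_mem_wordBall hgw hpw)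
      (inv_mem_wordBall hgw)), fun j k => ?_, ?_⟩
    · have h1 : 1 ≤ 2 ^ i := Nat.one_le_two_pow
      have h2 : m * (N + 1) ≤ 2 ^ i * (N + 1) := Nat.mul_le_mul_right _ hmi
      nlinarith
    · refine (hpn.conj_entry_le hgn j k).trans_lt (lt_of_le_of_lt ?_ hsi)
      have h1 : ((2 : ℝ) ^ c) ^ m = 2 ^ (c * m) := (pow_mul _ _ _).symm
      -- Conjugation expands by at most 2^(2c(m+1)). As F ≥ 4cm ≥ 2cm + m, the factor 2^(2cm) is
      -- cancelled and 2^(2c) · 2^(-m) remains, which tends to 0.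
      have h2 : (1 / 2 : ℝ) ^ Nat.fib (i + 1) ≤ (1 / 2) ^ (2 * (c * m) + m) := by
        refine pow_le_pow_of_le_one (by norm_num) (by norm_num) (le_trans ?_ hm4)
        nlinarith
      have h3 : (2 ^ (c * m) : ℝ) ^ 2 * (1 / 2) ^ (2 * (c * m)) = 1 := by
        rw [← pow_mul, mul_comm (c * m) 2, ← mul_pow]; norm_num
      calc _ ≤ (((2 : ℝ) ^ c) ^ m * 2 ^ c) ^ 2 * (1 / 2) ^ (2 * (c * m) + m) :=
            mul_le_mul_of_nonneg_left h2 (by positivity)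
        _ = (2 ^ c) ^ 2 * (1 / 2 : ℝ) ^ m * ((2 ^ (c * m) : ℝ) ^ 2 * (1 / 2) ^ (2 * (c * m))) := by
            rw [h1, pow_add]; ring
        _ = _ := by rw [h3, mul_one]
    · rw [slTrace_conj]; linarith
  · rw [Finset.card_image_of_injective _ hinj]
    simp only [Finset.card_univ, Fintype.card_fun, Fintype.card_bool, Fintype.card_fin]
    push_cast
    rw [← Real.rpow_natCast 2 m]
    exact Real.rpow_le_rpow_of_exponent_le one_le_two hi

end Counting

/-! ### Lifting from PSL(2, ℝ) to SL(2, ℝ) -/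

section Center

theorem mk_eq_one_of_scalar {X : SpecialLinearGroup (Fin 2) ℝ} (h01 : X 0 1 = 0) (h10 : X 1 0 = 0)
    (h : X 0 0 = X 1 1) : (X : PSL2R) = 1 := by
  have hd := det_fin_two_eq_one X
  rw [QuotientGroup.eq_one_iff, Matrix.SpecialLinearGroup.mem_center_iff]
  refine ⟨X 0 0, ?_, ?_⟩
  · rw [Fintype.card_fin]
    rw [h01, ← h] at hd
    linarith
  · ext i j
    fin_cases i <;> fin_cases j <;> simp [h01, h10, h]

theorem eq_or_eq_neg_of_mk_eq {X Y : SpecialLinearGroup (Fin 2) ℝ} (h : (X : PSL2R) = Y) :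
    Y = X ∨ Y = -X := by
  rw [QuotientGroup.eq, Matrix.SpecialLinearGroup.mem_center_iff] at h
  obtain ⟨r, hr, h⟩ := h
  rw [Fintype.card_fin, sq, mul_self_eq_one_iff] at hr
  rcases hr with rfl | rfl
  · left
    have : X⁻¹ * Y = 1 := Subtype.ext (by rw [← h]; simp)
    exact (inv_mul_eq_one.1 this).symm
  · right
    have : X⁻¹ * Y = -1 := Subtype.ext (by
      rw [← h, map_neg, map_one]; rfl)
    rw [inv_mul_eq_iff_eq_mul.1 this, mul_neg, mul_one]

theorem slTrace_neg (X : SpecialLinearGroup (Fin 2) ℝ) : slTrace (-X) = -slTrace X := by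
  simp only [slTrace, Matrix.SpecialLinearGroup.coe_neg, Matrix.neg_apply]; ring

end Center

/-! ### The action on the circle at infinity -/

section Projective

theorem mk_eq_mk_iff_wedge {u v : Fin 2 → ℝ} (hu : u ≠ 0) (hv : v ≠ 0) :
    Projectivization.mk ℝ u hu = Projectivization.mk ℝ v hv ↔ wedge u v = 0 := by
  rw [Projectivization.mk_eq_mk_iff']
  constructor
  · rintro ⟨c, rfl⟩
    simp only [wedge, Pi.smul_apply, smul_eq_mul]; ring
  · intro h
    obtain ⟨c, hc⟩ := exists_smul_of_wedge_eq_zero hv h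
    exact ⟨c, hc.symm⟩

theorem coe_smul_mk (X : SpecialLinearGroup (Fin 2) ℝ) {v : Fin 2 → ℝ} (hv : v ≠ 0) :
    (X : PSL2R) • Projectivization.mk ℝ v hv =
      Projectivization.mk ℝ (slAct X v) (slAct_ne_zero X hv) := by
  rw [Matrix.ProjectiveSpecialLinearGroup.smul_proj_mk, Projectivization.smul_mk]
  have : X • v = slAct X v := by rw [slAct_eq_mulVec]; rfl
  congr

theorem coe_smul_mk_eq_iff (X : SpecialLinearGroup (Fin 2) ℝ) {v : Fin 2 → ℝ} (hv : v ≠ 0) :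
    (X : PSL2R) • Projectivization.mk ℝ v hv = Projectivization.mk ℝ v hv ↔
      wedge (slAct X v) v = 0 := by
  rw [coe_smul_mk, mk_eq_mk_iff_wedge]

/-- The binary quadratic form v ↦ `wedge (slAct X v) v` has coefficients `-X 1 0`, `X 0 0 - X 1 1`
and `X 0 1`. It vanishes on three distinct lines, hence identically; the linear combinations below
are Lagrange interpolation. -/
theorem eq_one_of_fixes_three {g : PSL2R} {p q r : ℙ ℝ (Fin 2 → ℝ)} (hpq : p ≠ q) (hpr : p ≠ r)
    (hqr : q ≠ r) (hp : g • p = p) (hq : g • q = q) (hr : g • r = r) : g = 1 := by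
  induction g using QuotientGroup.induction_on with | H X => ?_
  induction p with | h u hu => ?_
  induction q with | h v hv => ?_
  induction r with | h w hw => ?_
  rw [Ne, mk_eq_mk_iff_wedge] at hpq hpr hqr
  rw [coe_smul_mk_eq_iff] at hp hq hr
  simp only [wedge, slAct_zero, slAct_one] at hp hq hr hpq hpr hqr
  have hne := mul_ne_zero (mul_ne_zero hpq hpr) hqr
  refine mk_eq_one_of_scalar ?_ ?_ ?_
  · apply (mul_eq_zero.1 (?_ : X 0 1 * _ = 0)).resolve_right hne
    linear_combination (v 0 * w 1 - v 1 * w 0) * (v 0 * w 0) * hp -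
      (u 0 * w 1 - u 1 * w 0) * (u 0 * w 0) * hq + (u 0 * v 1 - u 1 * v 0) * (u 0 * v 0) * hr
  · apply (mul_eq_zero.1 (?_ : X 1 0 * _ = 0)).resolve_right hne
    linear_combination -(v 0 * w 1 - v 1 * w 0) * (v 1 * w 1) * hp +
      (u 0 * w 1 - u 1 * w 0) * (u 1 * w 1) * hq - (u 0 * v 1 - u 1 * v 0) * (u 1 * v 1) * hr
  · rw [← sub_eq_zero]
    apply (mul_eq_zero.1 (?_ : (X 0 0 - X 1 1) * _ = 0)).resolve_right hne
    linear_combination -(v 0 * w 1 - v 1 * w 0) * (v 0 * w 1 + v 1 * w 0) * hp +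
      (u 0 * w 1 - u 1 * w 0) * (u 0 * w 1 + u 1 * w 0) * hq -
      (u 0 * v 1 - u 1 * v 0) * (u 0 * v 1 + u 1 * v 0) * hr

end Projective

/-! ### Neighbourhoods of the identity -/

section Nondiscrete

theorem exists_mem_nhds_ne_one {H : Subgroup PSL2R} (hdisc : ¬ DiscreteTopology H)
    {U : Set (SpecialLinearGroup (Fin 2) ℝ)} (hU : U ∈ 𝓝 1) :
    ∃ X ∈ U, (X : PSL2R) ∈ H ∧ (X : PSL2R) ≠ 1 := by
  by_contra! hcon
  apply hdisc
  apply discreteTopology_of_isOpen_singleton_one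
  have h1 : (QuotientGroup.mk '' U : Set PSL2R) ∈ 𝓝 1 :=
    QuotientGroup.isOpenMap_coe.image_mem_nhds hU
  have h2 : (Subtype.val ⁻¹' (QuotientGroup.mk '' U) : Set H) ∈ 𝓝 1 :=
    continuous_subtype_val.continuousAt.preimage_mem_nhds h1
  rw [isOpen_singleton_iff_nhds_eq_pure]
  refine le_antisymm (le_pure_iff.2 (mem_of_superset h2 ?_)) (pure_le_nhds _)
  rintro ⟨y, hy⟩ ⟨X, hX, rfl⟩
  exact Subtype.ext (hcon X hX hy)

theorem exists_forall_abs_lt_imp_mem {U : Set (SpecialLinearGroup (Fin 2) ℝ)} (hU : U ∈ 𝓝 1) :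
    ∃ ε > 0, ∀ X : SpecialLinearGroup (Fin 2) ℝ,
      (∀ i j, |X i j - (1 : Matrix (Fin 2) (Fin 2) ℝ) i j| < ε) → X ∈ U := by
  obtain ⟨V, hV, hVU⟩ := (mem_nhds_induced Subtype.val _ _).1 hU
  obtain ⟨ε, hε, h⟩ := (Metric.mem_nhds_iff (α := Fin 2 → Fin 2 → ℝ)).1 hV
  refine ⟨ε, hε, fun X hX => hVU (h ?_)⟩
  exact (dist_pi_lt_iff hε).2 fun i => (dist_pi_lt_iff hε).2 fun j => hX i j

theorem continuous_entry (i j : Fin 2) :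
    Continuous fun X : SpecialLinearGroup (Fin 2) ℝ => X i j :=
  (continuous_apply_apply i j).comp continuous_subtype_val

theorem continuous_slTrace : Continuous slTrace :=
  (continuous_entry 0 0).add (continuous_entry 1 1)

theorem eventually_abs_entry_le {ε : ℝ} (hε : 0 < ε) :
    ∀ᶠ X : SpecialLinearGroup (Fin 2) ℝ in 𝓝 1,
      ∀ i j, |X i j - (1 : Matrix (Fin 2) (Fin 2) ℝ) i j| ≤ ε := by
  rw [eventually_all]
  intro i
  rw [eventually_all]
  intro j
  have h : Tendsto (fun X : SpecialLinearGroup (Fin 2) ℝ =>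
      |X i j - (1 : Matrix (Fin 2) (Fin 2) ℝ) i j|) (𝓝 1) (𝓝 0) := by
    refine (((continuous_entry i j).sub continuous_const).abs).tendsto' _ _ ?_
    simp
  exact (h.eventually_lt_const hε).mono fun _ => le_of_lt

end Nondiscrete

/-! ### Small elements that move given points at infinity -/

section Elementary

/-- An orbit of at most two points is either a fixed point or the endpoint pair of a preserved axis.
-/
theorem exists_orbit_three {H : Subgroup PSL2R} (helem : ¬ IsElementary H)
    (p : ℙ ℝ (Fin 2 → ℝ)) : ∃ g ∈ H, ∃ h ∈ H, p ≠ g • p ∧ p ≠ h • p ∧ g • p ≠ h • p := by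
  by_contra! hcon
  have h1 : ∃ g ∈ H, g • p ≠ p := by
    by_contra! h
    exact helem (Or.inr (Or.inl ⟨p, h⟩))
  obtain ⟨g, hg, hgp⟩ := h1
  have key : ∀ h ∈ H, h • p = p ∨ h • p = g • p := fun h hh => by
    by_contra! hne
    exact hne.2 (hcon g hg h hh hgp.symm hne.1.symm).symm
  refine helem (Or.inr (Or.inr ⟨p, g • p, hgp.symm, fun h hh => ?_⟩))
  have k1 := key h hh
  have k2 := key (h * g) (H.mul_mem hh hg)
  rw [mul_smul] at k2
  have k3 : h • p ≠ h • g • p := fun e => hgp (MulAction.injective h e).symm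
  rcases k1 with k1 | k1 <;> rcases k2 with k2 | k2 <;> rw [k1, k2]
  · exact absurd (k1.trans k2.symm) k3
  · exact Set.pair_comm _ _
  · exact absurd (k1.trans k2.symm) k3

theorem tendsto_inv_mul_mul_nhds_one {G : Type*} [Group G] [TopologicalSpace G]
    [IsTopologicalGroup G] (g : G) : Tendsto (fun X => g⁻¹ * X * g) (𝓝 1) (𝓝 1) := by
  refine Continuous.tendsto' (by fun_prop) _ _ (by simp)

/-- Take a nontrivial X so close to 1 that its conjugates by g⁻¹ and h⁻¹ are still in `U`. If all
three fixed the line of v, X would fix three points p, gp, hp of an orbit. -/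
theorem exists_mem_nhds_wedge_ne_zero {H : Subgroup PSL2R} (hdisc : ¬ DiscreteTopology H)
    (helem : ¬ IsElementary H) {U : Set (SpecialLinearGroup (Fin 2) ℝ)} (hU : U ∈ 𝓝 1)
    {v : Fin 2 → ℝ} (hv : v ≠ 0) :
    ∃ A ∈ U, (A : PSL2R) ∈ H ∧ wedge (slAct A v) v ≠ 0 := by
  obtain ⟨g, hg, h, hh, h1, h2, h3⟩ := exists_orbit_three helem (Projectivization.mk ℝ v hv)
  induction g using QuotientGroup.induction_on with | H g => ?_
  induction h using QuotientGroup.induction_on with | H h => ?_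
  obtain ⟨X, ⟨hX1, hX2, hX3⟩, hXH, hX⟩ := exists_mem_nhds_ne_one hdisc
    (inter_mem hU (inter_mem (tendsto_inv_mul_mul_nhds_one g hU)
      (tendsto_inv_mul_mul_nhds_one h hU)))
  by_contra! hcon
  have conj : ∀ k : SpecialLinearGroup (Fin 2) ℝ, (k : PSL2R) ∈ H → k⁻¹ * X * k ∈ U →
      (X : PSL2R) • (k : PSL2R) • Projectivization.mk ℝ v hv =
        (k : PSL2R) • Projectivization.mk ℝ v hv := by
    intro k hk hkU
    have := hcon _ hkU (H.mul_mem (H.mul_mem (H.inv_mem hk) hXH) hk)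
    rw [← coe_smul_mk_eq_iff _ hv, QuotientGroup.mk_mul, QuotientGroup.mk_mul, mul_smul, mul_smul,
      QuotientGroup.mk_inv, inv_smul_eq_iff] at this
    exact this
  exact hX (eq_one_of_fixes_three h1 h2 h3 ((coe_smul_mk_eq_iff X hv).2 (hcon X hX1 hXH))
    (conj g hg hX2) (conj h hh hX3))

theorem exists_mem_nhds_wedge_ne_zero_two {H : Subgroup PSL2R} (hdisc : ¬ DiscreteTopology H)
    (helem : ¬ IsElementary H) {U : Set (SpecialLinearGroup (Fin 2) ℝ)} (hU : U ∈ 𝓝 1)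
    {v w : Fin 2 → ℝ} (hv : v ≠ 0) (hw : w ≠ 0) :
    ∃ A ∈ U, (A : PSL2R) ∈ H ∧ wedge (slAct A v) v ≠ 0 ∧ wedge (slAct A w) w ≠ 0 := by
  obtain ⟨V, hV, hVU⟩ := exists_nhds_one_split hU
  have h1V : (1 : SpecialLinearGroup (Fin 2) ℝ) ∈ V := mem_of_mem_nhds hV
  have hVU' : V ⊆ U := fun x hx => by simpa using hVU x hx 1 h1V
  obtain ⟨A, hA, hAH, hAv⟩ := exists_mem_nhds_wedge_ne_zero hdisc helem hV hv
  obtain ⟨B, hB, hBH, hBw⟩ := exists_mem_nhds_wedge_ne_zero hdisc helem hV hw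
  by_cases hAw : wedge (slAct A w) w = 0
  · by_cases hBv : wedge (slAct B v) v = 0
    -- A moves v and fixes w, B moves w and fixes v, as lines; then AB moves both.
    · refine ⟨A * B, hVU A hA B hB, H.mul_mem hAH hBH, ?_, ?_⟩
      · obtain ⟨c, hc⟩ := exists_smul_of_wedge_eq_zero hv hBv
        have hc0 : c ≠ 0 := by
          rintro rfl
          exact slAct_ne_zero B hv (by rw [hc, zero_smul])
        rw [slAct_mul, hc, slAct_smul, wedge_smul_left]
        exact mul_ne_zero hc0 hAv
      · obtain ⟨c, hc⟩ := exists_smul_of_wedge_eq_zero hw hAw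
        intro h
        have h' : wedge (slAct (A * B) w) (slAct A w) = 0 := by
          rw [hc, wedge_smul_right, h, mul_zero]
        rw [slAct_mul, wedge_slAct] at h'
        exact hBw h'
    · exact ⟨B, hVU' hB, hBH, hBv, hBw⟩
  · exact ⟨A, hVU' hA, hAH, hAv, hAw⟩

end Elementary

/-! ### Hyperbolic elements near the identity -/

section Hyperbolic

/-- The terms added to 2 are -det(Xs - sX), written out in the entries of this traceless matrix. -/
theorem slTrace_mul_inv_mul_inv_mul (X s : SpecialLinearGroup (Fin 2) ℝ) :
    slTrace (X * s⁻¹ * X⁻¹ * s) = 2 + (X 0 1 * s 1 0 - X 1 0 * s 0 1) ^ 2 +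
      ((X 0 0 - X 1 1) * s 0 1 - X 0 1 * (s 0 0 - s 1 1)) *
      (X 1 0 * (s 0 0 - s 1 1) - (X 0 0 - X 1 1) * s 1 0) := by
  have hs := det_fin_two_eq_one s
  have hX := det_fin_two_eq_one X
  obtain ⟨s1, s2, s3, s4⟩ := inv_entry s
  obtain ⟨x1, x2, x3, x4⟩ := inv_entry X
  simp only [slTrace, mul_entry, s1, s2, s3, s4, x1, x2, x3, x4]
  linear_combination 2 * ((X 0 0 * X 1 1 - X 0 1 * X 1 0) * hs + hX)

/-- A parabolic or elliptic element of `SL(2, ℝ)` has a fixed point that is fixed by every `s`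
whose commutator with the element is not hyperbolic. -/
theorem exists_fixed_of_slTrace_le_two {X : SpecialLinearGroup (Fin 2) ℝ} (hX1 : (X : PSL2R) ≠ 1)
    (h0 : -2 ≤ slTrace X) (h2 : slTrace X ≤ 2) :
    (∃ z : ℍ, ∀ s : SpecialLinearGroup (Fin 2) ℝ,
      slTrace (X * s⁻¹ * X⁻¹ * s) ≤ 2 → s • z = z) ∨
    ∃ v : Fin 2 → ℝ, v ≠ 0 ∧ ∀ s : SpecialLinearGroup (Fin 2) ℝ,
      slTrace (X * s⁻¹ * X⁻¹ * s) ≤ 2 → wedge (slAct s v) v = 0 := by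
  have hX := det_fin_two_eq_one X
  obtain ⟨u, hu⟩ : ∃ u, u = (X 0 0 - X 1 1) / 2 := ⟨_, rfl⟩
  have hu' : X 0 0 - X 1 1 = 2 * u := by rw [hu]; ring
  -- D is the determinant of the traceless part of X: zero in the parabolic case, positive in the
  -- elliptic case.
  obtain ⟨D, hD⟩ : ∃ D, D = -(u ^ 2 + X 0 1 * X 1 0) := ⟨_, rfl⟩
  have hD0 : 0 ≤ D := by
    have : D = 1 - slTrace X ^ 2 / 4 := by
      rw [hD, hu, slTrace]; linear_combination hX
    nlinarith
  by_cases hc : X 1 0 = 0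
  · have hu0 : u = 0 := by
      rw [hc] at hD
      nlinarith
    have hb : X 0 1 ≠ 0 := fun hb => hX1 (mk_eq_one_of_scalar hb hc (by linarith))
    refine Or.inr ⟨![1, 0], fun h => by simpa using congrFun h 0, fun s hs => ?_⟩
    rw [slTrace_mul_inv_mul_inv_mul, hu', hu0, hc] at hs
    have h3 : (X 0 1 * s 1 0) ^ 2 = 0 := le_antisymm (by linarith) (sq_nonneg _)
    have h4 : s 1 0 = 0 := by simpa [hb] using h3
    simp [wedge, slAct, h4]
  · have key : ∀ s : SpecialLinearGroup (Fin 2) ℝ, slTrace (X * s⁻¹ * X⁻¹ * s) ≤ 2 →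
        X 1 0 * (X 0 1 * s 1 0 - X 1 0 * s 0 1) -
          u * (X 1 0 * (s 0 0 - s 1 1) - 2 * u * s 1 0) = 0 ∧
        D * (X 1 0 * (s 0 0 - s 1 1) - 2 * u * s 1 0) ^ 2 = 0 := by
      intro s hs
      rw [slTrace_mul_inv_mul_inv_mul, hu'] at hs
      -- Completing the square: (X 1 0)² times the trace excess is a square plus D times a square,
      -- so a nonpositive excess makes both terms vanish.
      have e : (X 1 0 * (X 0 1 * s 1 0 - X 1 0 * s 0 1) -
          u * (X 1 0 * (s 0 0 - s 1 1) - 2 * u * s 1 0)) ^ 2 +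
          D * (X 1 0 * (s 0 0 - s 1 1) - 2 * u * s 1 0) ^ 2 =
          X 1 0 ^ 2 * ((X 0 1 * s 1 0 - X 1 0 * s 0 1) ^ 2 +
          (2 * u * s 0 1 - X 0 1 * (s 0 0 - s 1 1)) *
          (X 1 0 * (s 0 0 - s 1 1) - 2 * u * s 1 0)) := by
        rw [hD]; ring
      have e1 : X 1 0 ^ 2 * ((X 0 1 * s 1 0 - X 1 0 * s 0 1) ^ 2 +
          (2 * u * s 0 1 - X 0 1 * (s 0 0 - s 1 1)) *
          (X 1 0 * (s 0 0 - s 1 1) - 2 * u * s 1 0)) ≤ 0 :=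
        mul_nonpos_of_nonneg_of_nonpos (sq_nonneg _) (by linarith)
      rw [← e] at e1
      have e2 := mul_nonneg hD0 (sq_nonneg (X 1 0 * (s 0 0 - s 1 1) - 2 * u * s 1 0))
      have e3 := sq_nonneg (X 1 0 * (X 0 1 * s 1 0 - X 1 0 * s 0 1) -
          u * (X 1 0 * (s 0 0 - s 1 1) - 2 * u * s 1 0))
      exact ⟨pow_eq_zero_iff (two_ne_zero) |>.1 (le_antisymm (by linarith) e3),
        le_antisymm (by linarith) e2⟩
    rcases hD0.eq_or_lt with hD00 | hDpos
    · refine Or.inr ⟨![u, X 1 0], fun h => hc (by simpa using congrFun h 1), fun s hs => ?_⟩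
      obtain ⟨k1, -⟩ := key s hs
      have k2 : u ^ 2 + X 0 1 * X 1 0 = 0 := by linarith
      simp only [wedge, slAct, Matrix.cons_val_zero, Matrix.cons_val_one]
      linear_combination -k1 + s 1 0 * k2
    · left
      -- The fixed point of X in the upper half-plane is the root (u ± i√D) / `X 1 0` of its
      -- fixed-point equation; the absolute value picks the sign.
      have hy : 0 < √D / |X 1 0| := div_pos (Real.sqrt_pos.2 hDpos) (abs_pos.2 hc)
      refine ⟨⟨⟨u / X 1 0, √D / |X 1 0|⟩, hy⟩, fun s hs => ?_⟩
      obtain ⟨k1, k2⟩ := key s hs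
      have k3 : X 1 0 * (s 0 0 - s 1 1) = 2 * u * s 1 0 := by
        have := (mul_eq_zero.1 k2).resolve_left hDpos.ne'
        linarith [pow_eq_zero_iff (two_ne_zero) |>.1 this]
      have k4 : X 0 1 * s 1 0 = X 1 0 * s 0 1 := by
        rw [k3, sub_self, mul_zero, sub_zero] at k1
        linarith [(mul_eq_zero.1 k1).resolve_left hc]
      have hre : X 1 0 * (u / X 1 0) = u := by field_simp
      have him : X 1 0 ^ 2 * (√D / |X 1 0|) ^ 2 = D := by
        rw [div_pow, Real.sq_sqrt hD0, sq_abs]; field_simp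
      generalize u / X 1 0 = x at *
      generalize √D / |X 1 0| = y at *
      apply UpperHalfPlane.ext
      rw [UpperHalfPlane.specialLinearGroup_apply]
      have hsd := det_fin_two_eq_one s
      have hden : ((s 1 0 : ℝ) : ℂ) * (⟨x, y⟩ : ℂ) + ((s 1 1 : ℝ) : ℂ) ≠ 0 := by
        intro h
        have h1 := congrArg Complex.im h
        have h2 := congrArg Complex.re h
        simp at h1 h2
        rcases h1 with h1 | h1
        · rw [h1] at h2 hsd
          simp at h2
          rw [h2] at hsd
          simp at hsd
        · exact hy.ne' h1
      change (((s 0 0 : ℝ) : ℂ) * (⟨x, y⟩ : ℂ) + ((s 0 1 : ℝ) : ℂ)) /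
        (((s 1 0 : ℝ) : ℂ) * (⟨x, y⟩ : ℂ) + ((s 1 1 : ℝ) : ℂ)) = ⟨x, y⟩
      rw [div_eq_iff hden]
      apply Complex.ext
      · simp only [Complex.add_re, Complex.mul_re, Complex.mul_im, Complex.add_im,
          Complex.ofReal_re, Complex.ofReal_im]
        apply mul_left_cancel₀ (pow_ne_zero 2 hc)
        linear_combination X 1 0 * x * k3 + (2 * u * s 1 0 - s 1 0 * (X 1 0 * x + u)) * hre +
          s 1 0 * him + s 1 0 * hD - X 1 0 * k4
      · simp only [Complex.add_re, Complex.mul_re, Complex.mul_im, Complex.add_im,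
          Complex.ofReal_re, Complex.ofReal_im]
        apply mul_left_cancel₀ hc
        linear_combination y * k3 - 2 * s 1 0 * y * hre

theorem neg_one_smul_upperHalfPlane (z : ℍ) : (-1 : SpecialLinearGroup (Fin 2) ℝ) • z = z := by
  apply UpperHalfPlane.ext
  rw [UpperHalfPlane.specialLinearGroup_apply]
  simp

theorem smul_eq_of_mem_closure {S : Set PSL2R} {z : ℍ}
    (hS : ∀ s ∈ S, ∃ g : SpecialLinearGroup (Fin 2) ℝ, (g : PSL2R) = s ∧ g • z = z)
    {g : SpecialLinearGroup (Fin 2) ℝ} (hg : (g : PSL2R) ∈ Subgroup.closure S) : g • z = z := by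
  have h : Subgroup.closure S ≤ (MulAction.stabilizer (SpecialLinearGroup (Fin 2) ℝ) z).map
      (QuotientGroup.mk' _) := by
    rw [Subgroup.closure_le]
    intro s hs
    obtain ⟨k, rfl, hk⟩ := hS s hs
    exact ⟨k, hk, rfl⟩
  obtain ⟨k, hk, hkg⟩ := h hg
  have hk' : k • z = z := hk
  rcases eq_or_eq_neg_of_mk_eq hkg with rfl | rfl
  · exact hk'
  · rw [← neg_one_mul, mul_smul, hk', neg_one_smul_upperHalfPlane]

/-- Take a nontrivial X near 1 in H. If neither X nor its commutators with the generators were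
hyperbolic, each generator would fix a common point and H would be elementary. Finiteness of S keeps
all these commutators in `U` at once. -/
theorem exists_mem_nhds_two_lt_slTrace {H : Subgroup PSL2R} {S : Set PSL2R} (hS : S.Finite)
    (hSH : Subgroup.closure S = H) (hdisc : ¬ DiscreteTopology H) (helem : ¬ IsElementary H)
    {U : Set (SpecialLinearGroup (Fin 2) ℝ)} (hU : U ∈ 𝓝 1) :
    ∃ B ∈ U, (B : PSL2R) ∈ H ∧ 2 < slTrace B := by
  have hlift : ∀ s : PSL2R, ∃ g : SpecialLinearGroup (Fin 2) ℝ, (g : PSL2R) = s :=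
    fun s => QuotientGroup.mk_surjective s
  choose σ hσ using hlift
  have h1 : ∀ᶠ X : SpecialLinearGroup (Fin 2) ℝ in 𝓝 1,
      ∀ s ∈ S, X * (σ s)⁻¹ * X⁻¹ * σ s ∈ U := by
    refine (eventually_all_finite hS).2 fun s _ => ?_
    have : Tendsto (fun X : SpecialLinearGroup (Fin 2) ℝ => X * (σ s)⁻¹ * X⁻¹ * σ s)
        (𝓝 1) (𝓝 1) := Continuous.tendsto' (by fun_prop) _ _ (by simp)
    exact this hU
  have h2 : ∀ᶠ X : SpecialLinearGroup (Fin 2) ℝ in 𝓝 1, -2 < slTrace X := by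
    apply continuous_slTrace.continuousAt.eventually_const_lt
    norm_num [slTrace]
  obtain ⟨X, ⟨hX1, hX2, hXU⟩, hXH, hX⟩ := exists_mem_nhds_ne_one hdisc (h1.and (h2.and hU))
  by_cases hlt : 2 < slTrace X
  · exact ⟨X, hXU, hXH, hlt⟩
  by_contra! hcon
  have hSle : ∀ s ∈ S, slTrace (X * (σ s)⁻¹ * X⁻¹ * σ s) ≤ 2 := by
    intro s hs
    have hσH : ((σ s : SpecialLinearGroup (Fin 2) ℝ) : PSL2R) ∈ H := by
      rw [hσ, ← hSH]; exact Subgroup.subset_closure hs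
    exact hcon _ (hX1 s hs) (H.mul_mem (H.mul_mem (H.mul_mem hXH (H.inv_mem hσH))
      (H.inv_mem hXH)) hσH)
  rcases exists_fixed_of_slTrace_le_two hX hX2.le (not_lt.1 hlt) with ⟨z, hz⟩ | ⟨v, hv, hvs⟩
  · refine helem (Or.inl ⟨z, fun g hg => ?_⟩)
    rw [← hSH] at hg
    exact smul_eq_of_mem_closure (fun s hs => ⟨σ s, hσ s, hz _ (hSle s hs)⟩) hg
  · refine helem (Or.inr (Or.inl ⟨Projectivization.mk ℝ v hv, fun g hg => ?_⟩))
    have h : Subgroup.closure S ≤ MulAction.stabilizer PSL2R (Projectivization.mk ℝ v hv) := by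
      rw [Subgroup.closure_le]
      intro s hs
      have := (coe_smul_mk_eq_iff (σ s) hv).2 (hvs _ (hSle s hs))
      rwa [hσ] at this
    rw [hSH] at h
    exact h hg

theorem exists_diagonalization {B : SpecialLinearGroup (Fin 2) ℝ} (hB : 2 < slTrace B) :
    ∃ (P : SpecialLinearGroup (Fin 2) ℝ) (lam : ℝ), 1 < lam ∧
      lam * lam - slTrace B * lam + 1 = 0 ∧ (P⁻¹ * B * P) 0 0 = lam ∧ (P⁻¹ * B * P) 0 1 = 0 ∧
      (P⁻¹ * B * P) 1 0 = 0 ∧ (P⁻¹ * B * P) 1 1 = lam⁻¹ := by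
  obtain ⟨lam, hlam, hroot⟩ := exists_root_of_two_lt hB
  have hl0 : lam ≠ 0 := by linarith
  have hroot' : lam⁻¹ * lam⁻¹ - slTrace B * lam⁻¹ + 1 = 0 := by
    field_simp; linarith
  obtain ⟨v, hv, hBv⟩ := exists_eigenvector_of_root hroot
  obtain ⟨w, hw, hBw⟩ := exists_eigenvector_of_root hroot'
  have hvw : wedge v w ≠ 0 := by
    intro h
    obtain ⟨c, rfl⟩ := exists_smul_of_wedge_eq_zero hw h
    rw [slAct_smul, hBw, smul_comm] at hBv
    have h1 := smul_left_injective ℝ hv hBv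
    have h2 : lam⁻¹ < 1 := inv_lt_one_of_one_lt₀ hlam
    linarith
  have hdet : (!![v 0, w 0 / wedge v w; v 1, w 1 / wedge v w] : Matrix (Fin 2) (Fin 2) ℝ).det
      = 1 := by
    rw [Matrix.det_fin_two_of, ← mul_div_assoc, div_mul_eq_mul_div, ← sub_div, wedge,
      mul_comm (w 0)]
    exact div_self hvw
  obtain ⟨P, P00, P01, P10, P11⟩ : ∃ P : SpecialLinearGroup (Fin 2) ℝ, P 0 0 = v 0 ∧
      P 0 1 = w 0 / wedge v w ∧ P 1 0 = v 1 ∧ P 1 1 = w 1 / wedge v w :=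
    ⟨⟨_, hdet⟩, rfl, rfl, rfl, rfl⟩
  refine ⟨P, lam, hlam, hroot, ?_⟩
  have v0 := congrFun hBv 0
  have v1 := congrFun hBv 1
  have w0 := congrFun hBw 0
  have w1 := congrFun hBw 1
  simp only [slAct_zero, slAct_one, Pi.smul_apply, smul_eq_mul] at v0 v1 w0 w1
  have hd := det_fin_two_eq_one P
  have q00 : (B * P) 0 0 = lam * P 0 0 := by rw [mul_entry, P00, P10, v0]
  have q10 : (B * P) 1 0 = lam * P 1 0 := by rw [mul_entry, P00, P10, v1]
  have q01 : (B * P) 0 1 = lam⁻¹ * P 0 1 := by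
    rw [mul_entry, P01, P11, ← mul_div_assoc, ← mul_div_assoc, ← add_div, w0, mul_div_assoc]
  have q11 : (B * P) 1 1 = lam⁻¹ * P 1 1 := by
    rw [mul_entry, P01, P11, ← mul_div_assoc, ← mul_div_assoc, ← add_div, w1, mul_div_assoc]
  obtain ⟨i1, i2, i3, i4⟩ := inv_entry P
  rw [mul_assoc, mul_entry P⁻¹, mul_entry P⁻¹, mul_entry P⁻¹, mul_entry P⁻¹, q00, q01, q10, q11,
    i1, i2, i3, i4]
  refine ⟨by linear_combination lam * hd, by ring, by ring, by linear_combination lam⁻¹ * hd⟩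

/-- A finitely generated, non-discrete and non-elementary subgroup contains, up to conjugation in
`SL(2, ℝ)`, a diagonal hyperbolic element and an element fixing neither of its fixed points, both
close to the identity. -/
theorem exists_conj_diagonal_pair {H : Subgroup PSL2R} {S : Set PSL2R} (hS : S.Finite)
    (hSH : Subgroup.closure S = H) (hdisc : ¬ DiscreteTopology H) (helem : ¬ IsElementary H) :
    ∃ (P a b : SpecialLinearGroup (Fin 2) ℝ) (lam : ℝ), 1 < lam ∧ lam ≤ 1 + 1 / 64 ∧
      b 0 0 = lam ∧ b 0 1 = 0 ∧ b 1 0 = 0 ∧ b 1 1 = lam⁻¹ ∧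
      (∀ i j, |a i j - (1 : Matrix (Fin 2) (Fin 2) ℝ) i j| ≤ 1 / 64) ∧
      a 0 1 ≠ 0 ∧ a 1 0 ≠ 0 ∧ ((P * a * P⁻¹ : SpecialLinearGroup (Fin 2) ℝ) : PSL2R) ∈ H ∧
      ((P * b * P⁻¹ : SpecialLinearGroup (Fin 2) ℝ) : PSL2R) ∈ H := by
  -- The diagonalizing P is not controlled, so smallness of B is imposed on its trace, which
  -- conjugation preserves. An eigenvalue above 1 + 1/64 would make the trace exceed 2 + 1/4160.
  have h1 : ∀ᶠ X : SpecialLinearGroup (Fin 2) ℝ in 𝓝 1, slTrace X < 2 + 1 / 10000 := by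
    apply continuous_slTrace.continuousAt.eventually_lt_const
    norm_num [slTrace]
  obtain ⟨B, hB, hBH, hB2⟩ := exists_mem_nhds_two_lt_slTrace hS hSH hdisc helem h1
  obtain ⟨P, lam, hlam, hroot, b00, b01, b10, b11⟩ := exists_diagonalization hB2
  have hB' : slTrace B < 2 + 1 / 10000 := hB
  have e0 : (![1, 0] : Fin 2 → ℝ) ≠ 0 := fun h => by simpa using congrFun h 0
  have e1 : (![0, 1] : Fin 2 → ℝ) ≠ 0 := fun h => by simpa using congrFun h 1
  -- A is chosen after P, close enough to 1 that its conjugate by P⁻¹ is still within 1/64 of 1.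
  obtain ⟨A, hA, hAH, hA0, hA1⟩ := exists_mem_nhds_wedge_ne_zero_two hdisc helem
    (tendsto_inv_mul_mul_nhds_one P (eventually_abs_entry_le (ε := 1 / 64) (by norm_num)))
    (slAct_ne_zero P e0) (slAct_ne_zero P e1)
  have hc : ∀ v, wedge (slAct A (slAct P v)) (slAct P v) =
      wedge (slAct (P⁻¹ * A * P) v) v := fun v => by
    rw [← wedge_slAct P (slAct (P⁻¹ * A * P) v), ← slAct_mul, ← slAct_mul]
    congr 2
    group
  rw [hc] at hA0 hA1
  refine ⟨P, P⁻¹ * A * P, P⁻¹ * B * P, lam, hlam, ?_, b00, b01, b10, b11, hA, ?_, ?_, ?_, ?_⟩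
  · by_contra! hgt
    nlinarith
  · intro h
    apply hA1
    simp [wedge, slAct, h]
  · intro h
    apply hA0
    simp [wedge, slAct, h]
  · rwa [show P * (P⁻¹ * A * P) * P⁻¹ = A by group]
  · rwa [show P * (P⁻¹ * B * P) * P⁻¹ = B by group]

end Hyperbolic

/-! ### Comparison of growth rates -/

section Asymptotic

/-- For n between (D + 1)2^i and 2(D + 1)2^i, √n is at most a constant times √2^i, which is
negligible against (3/2)^i; monotonicity passes from the scale D · 2^i to n. -/
theorem isLittleO_two_rpow_sqrt_of_le {f : ℕ → ℕ} (hf : Monotone f) {D : ℕ} {κ : ℝ} (hκ : 0 < κ)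
    (h : ∀ᶠ i : ℕ in atTop, (2 : ℝ) ^ (κ * (3 / 2) ^ i) ≤ f (D * 2 ^ i)) :
    (fun n : ℕ => (2 : ℝ) ^ (√(n : ℝ) / 4)) =o[atTop] (fun n : ℕ => (f n : ℝ)) := by
  rw [isLittleO_iff]
  intro c hc
  -- Half of the exponent κ(3/2)^i will dominate √n / 4, the other half M, which yields the factor
  -- c.
  obtain ⟨M, hM⟩ : ∃ M : ℕ, (1 / 2 : ℝ) ^ M < c := exists_pow_lt_of_lt_one hc (by norm_num)
  have hs : √(2 : ℝ) < 3 / 2 := by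
    rw [Real.sqrt_lt' (by norm_num)]; norm_num
  have h1 : ∀ᶠ i : ℕ in atTop, √(2 * (D + 1) : ℝ) / 4 * √2 ^ i ≤ κ / 2 * (3 / 2) ^ i := by
    have := ((isLittleO_pow_pow_of_lt_left (Real.sqrt_nonneg 2) hs).const_mul_left
      (√(2 * (D + 1) : ℝ) / 4)).bound (half_pos hκ)
    filter_upwards [this] with i hi
    rw [Real.norm_of_nonneg (by positivity), Real.norm_of_nonneg (by positivity)] at hi
    exact hi
  have h2 : ∀ᶠ i : ℕ in atTop, (M : ℝ) ≤ κ / 2 * (3 / 2) ^ i :=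
    ((tendsto_pow_atTop_atTop_of_one_lt (by norm_num)).const_mul_atTop
      (half_pos hκ)).eventually_ge_atTop _
  obtain ⟨i₀, hi₀⟩ := eventually_atTop.1 (h.and (h1.and h2))
  filter_upwards [eventually_ge_atTop ((D + 1) * 2 ^ i₀)] with n hn
  obtain ⟨i, hi⟩ : ∃ i, i = Nat.log 2 (n / (D + 1)) := ⟨_, rfl⟩
  have hq : 2 ^ i₀ ≤ n / (D + 1) := by
    rw [Nat.le_div_iff_mul_le (by omega), mul_comm]; exact hn
  have hq0 : n / (D + 1) ≠ 0 := by
    have : 0 < 2 ^ i₀ := by positivity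
    omega
  have hii : i₀ ≤ i := hi ▸ Nat.le_log_of_pow_le (by norm_num) hq
  have hlow : (D + 1) * 2 ^ i ≤ n := by
    have := Nat.pow_log_le_self 2 hq0
    rw [← hi, Nat.le_div_iff_mul_le (by omega)] at this
    linarith
  have hup : n ≤ 2 * (D + 1) * 2 ^ i := by
    have := Nat.lt_pow_succ_log_self (b := 2) (by norm_num) (n / (D + 1))
    rw [← hi, Nat.div_lt_iff_lt_mul (by omega), pow_succ] at this
    linarith
  obtain ⟨g1, g2, g3⟩ := hi₀ i hii
  have hfn : (f (D * 2 ^ i) : ℝ) ≤ f n := by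
    exact_mod_cast hf (le_trans (Nat.mul_le_mul_right _ (Nat.le_succ D)) hlow)
  have hsq : √(n : ℝ) / 4 ≤ √(2 * (D + 1) : ℝ) / 4 * √2 ^ i := by
    have e : √((2 : ℝ) ^ i) = √2 ^ i := by
      rw [Real.sqrt_eq_iff_mul_self_eq (by positivity) (by positivity), ← mul_pow,
        Real.mul_self_sqrt (by norm_num)]
    have : √(n : ℝ) ≤ √(2 * (D + 1) * 2 ^ i : ℝ) := Real.sqrt_le_sqrt (by exact_mod_cast hup)
    rw [Real.sqrt_mul (by positivity), e] at this
    linarith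
  rw [Real.norm_of_nonneg (by positivity), Real.norm_of_nonneg (by positivity)]
  have h3 : √(n : ℝ) / 4 ≤ κ * (3 / 2) ^ i + -M := by linarith
  calc (2 : ℝ) ^ (√(n : ℝ) / 4) ≤ 2 ^ (κ * (3 / 2) ^ i + -M : ℝ) :=
        Real.rpow_le_rpow_of_exponent_le one_le_two h3
    _ = 2 ^ (κ * (3 / 2) ^ i) * (1 / 2) ^ M := by
        rw [Real.rpow_add two_pos, Real.rpow_neg zero_le_two, Real.rpow_natCast, one_div, inv_pow]
    _ ≤ f n * c := mul_le_mul (g1.trans hfn) hM.le (by positivity) (by positivity)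
    _ = c * f n := mul_comm _ _

theorem isLittleO_pow_two_rpow_sqrt (k : ℕ) :
    (fun n : ℕ => (n : ℝ) ^ k) =o[atTop] (fun n : ℕ => (2 : ℝ) ^ (√(n : ℝ) / 4)) := by
  have hc : 0 < Real.log 2 / 4 := div_pos (Real.log_pos one_lt_two) (by norm_num)
  have ht : Tendsto (fun n : ℕ => Real.log 2 / 4 * √(n : ℝ)) atTop atTop :=
    (Real.tendsto_sqrt_atTop.comp tendsto_natCast_atTop_atTop).const_mul_atTop hc
  have h := ((Real.isLittleO_pow_exp_atTop (n := 2 * k)).comp_tendsto ht).const_mul_left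
    ((Real.log 2 / 4) ^ (2 * k))⁻¹
  refine h.congr (fun n => ?_) (fun n => ?_)
  · simp only [Function.comp_apply]
    rw [mul_pow, inv_mul_cancel_left₀ (pow_ne_zero _ hc.ne'), pow_mul, Real.sq_sqrt (by positivity)]
  · simp only [Function.comp_apply]
    rw [Real.rpow_def_of_pos two_pos]
    congr 1
    ring

end Asymptotic

/-! ### Transfer to the semilocal growth of H -/

section SemilocalGrowth

theorem IsLeftInvariantMetric.eventually_le {L : Type*} [Group L] [TopologicalSpace L]
    {ρ : L → L → ℝ} (hρ : IsLeftInvariantMetric ρ) {ε : ℝ} (hε : 0 < ε) (x : L) :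
    ∀ᶠ y in 𝓝 x, ρ y x ≤ ε := by
  have hopen : IsOpen {y | ρ y x < ε} := by
    rw [hρ.isOpen_iff]
    intro y hy
    refine ⟨ε - ρ y x, sub_pos.2 hy, fun z hz => ?_⟩
    have := hρ.triangle z y x
    rw [hρ.symm z y] at this
    change ρ z x < ε
    linarith
  filter_upwards [hopen.mem_nhds (show ρ x x < ε by rwa [hρ.dist_self])] with y hy
  exact le_of_lt hy

theorem semilocalGrowth_mono {L : Type*} [Group L] (ρ : L → L → ℝ) {S : Set L} (hS : S.Finite)
    (ε : ℝ) : Monotone (semilocalGrowth ρ S ε) := fun _ n hmn =>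
  Set.ncard_le_ncard (fun _ hg => ⟨wordBall_mono S hmn hg.1, hg.2⟩)
    (finite_semilocalBall ρ hS ε n)

theorem exists_two_rpow_le_semilocalGrowth {ρ : PSL2R → PSL2R → ℝ}
    (hρ : IsLeftInvariantMetric ρ) {H : Subgroup PSL2R} {S : Set PSL2R} (hS : S.Finite)
    (hSH : Subgroup.closure S = H) (hdisc : ¬ DiscreteTopology H) (helem : ¬ IsElementary H)
    {ε₀ : ℝ} (hε₀ : 0 < ε₀) :
    ∃ (D : ℕ) (κ : ℝ), 0 < κ ∧
      ∀ᶠ i : ℕ in atTop, (2 : ℝ) ^ (κ * (3 / 2) ^ i) ≤ semilocalGrowth ρ S ε₀ (D * 2 ^ i) := by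
  obtain ⟨P, a, b, lam, hlam, hlam', b00, b01, b10, b11, ha, ha01, ha10, haH, hbH⟩ :=
    exists_conj_diagonal_pair hS hSH hdisc helem
  obtain ⟨φ, hφ⟩ : ∃ φ : SpecialLinearGroup (Fin 2) ℝ →* PSL2R,
      ∀ X, φ X = ((P * X * P⁻¹ : SpecialLinearGroup (Fin 2) ℝ) : PSL2R) :=
    ⟨(QuotientGroup.mk' _).comp (MulAut.conj P).toMonoidHom, fun X => rfl⟩
  have hφc : Continuous φ := by
    have : (φ : SpecialLinearGroup (Fin 2) ℝ → PSL2R) = fun X =>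
      ((P * X * P⁻¹ : SpecialLinearGroup (Fin 2) ℝ) : PSL2R) := funext hφ
    rw [this]
    exact QuotientGroup.continuous_mk.comp (by fun_prop)
  have hφ1 : Tendsto φ (𝓝 1) (𝓝 1) := hφc.tendsto' _ _ (map_one φ)
  obtain ⟨ε, hε, hεU⟩ := exists_forall_abs_lt_imp_mem (hφ1.eventually (hρ.eventually_le hε₀ 1))
  obtain ⟨C, κ, hκ, hev⟩ := exists_many_near_one hlam hlam' b00 b01 b10 b11 ha ha01 ha10 hε
  rw [← hφ, ← hSH] at haH hbH
  obtain ⟨m, hm⟩ := exists_mem_wordBall_of_mem_closure haH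
  obtain ⟨n, hn⟩ := exists_mem_wordBall_of_mem_closure hbH
  have hgen : ∀ x ∈ ({a, b} : Set (SpecialLinearGroup (Fin 2) ℝ)), φ x ∈ wordBall S (m + n) := by
    rintro x (rfl | rfl)
    exacts [wordBall_mono S (by omega) hm, wordBall_mono S (by omega) hn]
  refine ⟨C * (m + n), κ, hκ, hev.mono ?_⟩
  rintro i ⟨F, hF, hcard⟩
  refine hcard.trans (Nat.cast_le.2 ?_)
  -- Projecting to PSL(2, ℝ) identifies only X and -X, and the positive traces exclude the sign.
  have hinj : Set.InjOn φ F := by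
    intro x hx y hy hxy
    rw [hφ, hφ] at hxy
    have htx := (hF x hx).2.2
    have hty := (hF y hy).2.2
    rcases eq_or_eq_neg_of_mk_eq hxy with h | h
    · exact (mul_left_cancel (mul_right_cancel h)).symm
    · have := congrArg slTrace h
      rw [slTrace_neg, slTrace_conj, slTrace_conj] at this
      linarith
  rw [← Set.ncard_coe_finset, ← hinj.ncard_image]
  refine Set.ncard_le_ncard ?_ (finite_semilocalBall ρ hS ε₀ _)
  rintro _ ⟨x, hx, rfl⟩
  obtain ⟨hw, hx1, -⟩ := hF x hx
  refine ⟨wordBall_mono S (le_of_eq (by ring)) (map_mem_wordBall φ hgen hw), hεU x hx1⟩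

end SemilocalGrowth

theorem theorem5p19
    (ρ : PSL2R → PSL2R → ℝ) (hρ : IsLeftInvariantMetric ρ)
    (H : Subgroup PSL2R) (S : Set PSL2R) (hS : S.Finite) (hSH : Subgroup.closure S = H)
    (hdisc : ¬ DiscreteTopology H) (helem : ¬ IsElementary H)
    (ε₀ : ℝ) (hε₀ : 0 < ε₀) :
    (fun n : ℕ => (2 : ℝ) ^ (Real.sqrt (n : ℝ) / 4)) =o[atTop]
        (fun n : ℕ => (semilocalGrowth ρ S ε₀ n : ℝ)) ∧
      ∀ k : ℕ, (fun n : ℕ => (n : ℝ) ^ k) =o[atTop]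
        (fun n : ℕ => (semilocalGrowth ρ S ε₀ n : ℝ)) := by
  obtain ⟨D, κ, hκ, h⟩ := exists_two_rpow_le_semilocalGrowth hρ hS hSH hdisc helem hε₀
  have h1 := isLittleO_two_rpow_sqrt_of_le (semilocalGrowth_mono ρ hS ε₀) hκ h
  exact ⟨h1, fun k => (isLittleO_pow_two_rpow_sqrt k).trans h1⟩
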